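/- **Theorem 1.1 (Main result).** Let $M\ge 3$ be an integer and let $z^*$ denote complex conjugation. For $a>0$ and real $g\neq 0$, $\mu$, put $\theta_m=2\pi m/M$ and $\Delta_{km}=\theta_k-\theta_m$ ($0\le k,m\le M-1$), and $$A=-\frac{2ai}{a+i},\qquad B_\pm(\alpha)=-a(\pm 2i\alpha+1)\frac{1+ai}{1+a^2},$$ $$c_0=\frac{ga(a-i)}{(a+i)^2}\coth\frac{\pi A}{M},\qquad c^\pm(\alpha)=\frac{ga^2(\pm 2i\alpha+1)}{(a+i)^2}\coth\frac{\pi B_\pm(\alpha)}{M}.$$ The Alexander spiral with $M$ branches is given by $Z_m=t^\mu e^{a(\theta-\theta_m)}e^{i\theta}$, $\Gamma_m=g\,t^{2\mu-1}e^{2a(\theta-\theta_m)}$ ($0\le m\le M-1$), where $a,g,\mu$ satisfy $$a^2+1-2\mu+2a\mu i=-2a^2g\coth(\pi A/M).\tag{1}$$ The Birkhoff–Rott equation linearized about it is, for $0\le m\le M-1$, $t>0$, $\theta\in\mathbb R$, $$t\,\partial_t\zeta_m(t,\theta)^*-\frac{2\mu-1}{2a}\,\partial_\theta\zeta_m(t,\theta)^*=-\frac{ag}{\pi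 i}\,\mathrm{f.p.}\!\int_{-\infty}^\infty\sum_{k=0}^{M-1}\frac{\big(\zeta_m(t,\theta)-\zeta_k(t,\sigma+\theta+\Delta_{km})\big)e^{2a\sigma}e^{-2i\theta}}{\big(1-e^{(a+i)\sigma}e^{i\Delta_{km}}\big)^2}\,d\sigma,\tag{2}$$ where, for an integrand $F$ singular at $0$, $\mathrm{f.p.}\int_{-r}^{s}F=\lim_{\varepsilon\to0^+}\big(\int_{-r}^{-\varepsilon}F+\int_{\varepsilon}^{s}F-\varepsilon(F(\varepsilon)+F(-\varepsilon))\big)$ is the Hadamard finite part and $\mathrm{f.p.}\int_{-\infty}^\infty F=\lim_{r,s\to\infty}\mathrm{f.p.}\int_{-r}^sF$. (i) Let $a>0$ and $\alpha\in(0,\tfrac1{2a})\cup(\tfrac1{2a},\infty)$. There are constants $C,\delta>0$, depending only on $M,a,\alpha$, such that the following holds for all real $g\ne0$ and $\mu$ satisfying (1). If $$c^+(\alpha)\neq c^-(\alpha)\ \text{ and }\ c_0\ \text{does not lie on the real line through } c^+(\alpha)\text{ and }c^-(\alpha)\text{ in the complex plane},\tag{3}$$ then there are smooth functions $X_m,Y_m:(0,\infty)\to\mathbb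 C$ ($0\le m\le M-1$) such that $$\zeta_m(t,\theta)=X_m(t)\,\zeta_m^+(t,\theta)e^{i\theta}+Y_m(t)\,\zeta_m^-(t,\theta)e^{i\theta},\qquad \zeta_m^\pm(t,\theta)=e^{\pm i\alpha\left(2a(\theta-\theta_m)+(2\mu-1)\ln t\right)},$$ solves (2) (the derivatives and the finite part in (2) existing) and $\|\zeta(t,\cdot)\|_{L^\infty(\mathbb R;\mathbb C^M)}\ge C\,t^\delta$ for all $t>0$, where $\mathbb C^M$ carries the maximum norm. (ii) Condition (3) holds for all sufficiently large $a$ and all $\alpha\ne\frac1{2a}$ sufficiently close to $\frac1{2a}$: there is $a_0>0$ such that for every $a\ge a_0$ there is $\epsilon>0$ such that (3) holds for all $\alpha$ with $0<|\alpha-\frac1{2a}|<\epsilon$ and all real $g\neq0$. -/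

import Mathlib

open scoped ComplexConjugate ContDiff Topology
open MeasureTheory Set Filter

noncomputable section

/-- The finite interval Hadamard finite part: `HasFinitePart F a b x L` says that
`f.p. ∫_a^b F(t) dt` exists and equals `L`, where `F(t) = g(t) / (t - x)²` has a singularity of
order at most two at the interior point `x`. In terms of `g` the subtracted term is
`(g (x + ε) + g (x - ε)) / ε`, that is `ε * (F (x + ε) + F (x - ε))`. If
`F(t) = f(t) / (γ(t) - γ(x))²` for a curve `γ`, this is the finite part along the curve. -/
def HasFinitePart (F : ℝ → ℂ) (a b x : ℝ) (L : ℂ) : Prop :=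
  (∀ᶠ ε : ℝ in 𝓝[>] 0,
    IntervalIntegrable F volume a (x - ε) ∧ IntervalIntegrable F volume (x + ε) b) ∧
  Tendsto
    (fun ε : ℝ => (∫ t in a..(x - ε), F t) + (∫ t in (x + ε)..b, F t)
      - (ε : ℂ) * (F (x + ε) + F (x - ε)))
    (𝓝[>] 0) (𝓝 L)

/-- `f.p. ∫_{-∞}^{∞} F(σ) dσ` exists, with singular point `0`, and equals `L`: the finite parts over
`[-r, s]` exist for all `r, s > 0` and converge to `L` as `r, s → ∞` independently. -/
def HasImproperFinitePart (F : ℝ → ℂ) (L : ℂ) : Prop :=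
  ∃ G : ℝ → ℝ → ℂ,
    (∀ r s : ℝ, 0 < r → 0 < s → HasFinitePart F (-r) s 0 (G r s)) ∧
    Tendsto (fun p : ℝ × ℝ => G p.1 p.2) (atTop ×ˢ atTop) (𝓝 L)

/-- The branch angles `θ_m = 2 π m / M`. -/
def branchAngle (M : ℕ) (m : Fin M) : ℝ := 2 * Real.pi * (m : ℕ) / M

/-- The integrand, as a function of `σ`, of the operator `H_m` (without the prefactor `a g / (π i)`),
for a perturbation `z = (z_0, …, z_{M-1})` of the `M` branches at a fixed time. -/
def linBRIntegrand (M : ℕ) (a : ℝ) (z : Fin M → ℝ → ℂ) (m : Fin M) (θ σ : ℝ) : ℂ :=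
  ∑ k : Fin M,
    (z m θ - z k (σ + θ + (branchAngle M k - branchAngle M m)))
        * Complex.exp (2 * a * σ) * Complex.exp (-2 * Complex.I * θ)
      / (1 - Complex.exp ((a + Complex.I) * σ)
          * Complex.exp (Complex.I * (branchAngle M k - branchAngle M m : ℝ))) ^ 2

/-- `ζ m t θ` (branch `m`, time `t > 0`, angle `θ`) solves the Birkhoff–Rott equation linearized
about the Alexander spiral,
`t ∂_t ζ_m^* - (2μ - 1)/(2a) ∂_θ ζ_m^* = - H_m ζ`,
`H_m ζ = a g / (π i) f.p. ∫ (…) dσ`,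
where `^*` is complex conjugation. -/
def IsLinBRSolution (M : ℕ) (a g μ : ℝ) (ζ : Fin M → ℝ → ℝ → ℂ) : Prop :=
  ∀ (m : Fin M) (t θ : ℝ), 0 < t →
    ∃ Dt Dθ L : ℂ,
      HasDerivAt (fun s : ℝ => conj (ζ m s θ)) Dt t ∧
      HasDerivAt (fun φ : ℝ => conj (ζ m t φ)) Dθ θ ∧
      HasImproperFinitePart (linBRIntegrand M a (fun k => ζ k t) m θ) L ∧
      t * Dt - ((2 * μ - 1) / (2 * a) : ℝ) * Dθ = -((a * g : ℝ) / (Real.pi * Complex.I) * L)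

/-- The oscillations `ζ_m^±(t, θ) = exp (± i α ln (Γ_m(t, θ) / g))`, where
`ln (Γ_m / g) = 2 a (θ - θ_m) + (2 μ - 1) ln t`; here `ζ_m^+` is `β = α`, and `ζ_m^-` is `β = -α`. -/
def fourierMode (M : ℕ) (a μ β : ℝ) (m : Fin M) (t θ : ℝ) : ℂ :=
  Complex.exp (Complex.I *
    (β * (2 * a * (θ - branchAngle M m) + (2 * μ - 1) * Real.log t) : ℝ))

/-- The perturbation `ζ_m = X_m(t) ζ_m^+ e^{iθ} + Y_m(t) ζ_m^- e^{iθ}`. -/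
def modePerturbation (M : ℕ) (a μ α : ℝ) (X Y : Fin M → ℝ → ℂ) (m : Fin M) (t θ : ℝ) : ℂ :=
  X m t * fourierMode M a μ α m t θ * Complex.exp (Complex.I * θ)
    + Y m t * fourierMode M a μ (-α) m t θ * Complex.exp (Complex.I * θ)

/-- The complex hyperbolic cotangent. -/
def ccoth (z : ℂ) : ℂ := Complex.cosh z / Complex.sinh z

def spiralA (a : ℝ) : ℂ := -(2 * a * Complex.I / (a + Complex.I))

/-- `B_+(α)` is `spiralB a α`, and `B_-(α)` is `spiralB a (-α)`. -/
def spiralB (a β : ℝ) : ℂ :=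
  -a * (2 * Complex.I * β + 1) * ((1 + a * Complex.I) / (1 + a ^ 2))

/-- `c_0`. -/
def coeffZero (M : ℕ) (a g : ℝ) : ℂ :=
  g * a * (a - Complex.I) / (a + Complex.I) ^ 2 * ccoth (Real.pi * spiralA a / M)

/-- `c^+(α)` is `coeffMode M a g α`, and `c^-(α)` is `coeffMode M a g (-α)`. -/
def coeffMode (M : ℕ) (a g β : ℝ) : ℂ :=
  g * a ^ 2 * (2 * Complex.I * β + 1) / (a + Complex.I) ^ 2 * ccoth (Real.pi * spiralB a β / M)

/-- `c_0` does not lie on the line through the two distinct points `c^+(α)` and `c^-(α)` of the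
complex plane. -/
def NonCollinearCoeffs (M : ℕ) (a g α : ℝ) : Prop :=
  coeffMode M a g α ≠ coeffMode M a g (-α) ∧
  coeffZero M a g ∉ affineSpan ℝ {coeffMode M a g α, coeffMode M a g (-α)}

/-- The relation between `a`, `g ≠ 0` and `μ` under which the symmetric logarithmic spirals
`Z_m = t^μ e^{a (θ - θ_m)} e^{iθ}`, `Γ_m = g t^{2μ-1} e^{2a (θ - θ_m)}` form an Alexander spiral,
that is, solve the Birkhoff–Rott equation. -/
def IsAlexanderSpiral (M : ℕ) (a g μ : ℝ) : Prop :=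
  g ≠ 0 ∧
  (a : ℂ) ^ 2 + 1 - 2 * μ + 2 * a * μ * Complex.I
    = -2 * a ^ 2 * g * ccoth (Real.pi * spiralA a / M)

end

/-! The modes are invariant under the simultaneous change of branch and shift of angle in the
integrand, so the branch sum acts only on rational functions of w = e^{(a+i)σ}. Averaging over the
M-th roots of unity turns it into powers of w divided by (1 - w^M)², that is, into combinations of
e^{pσ}/sinh²(lσ) with l = M(a+i)/2.

The finite part of such a function is found by moving the contour to Im z = h and to Im z = -h. Each
shift contributes half a residue, with opposite signs. The two lines differ by the quasi-period T =
πi/l, which multiplies the integrand by e^{pT}. Comparing the two expressions for one finite part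
determines the shifted integral, and the result is a multiple of coth(pT/2)
(`hasImproperFinitePart_exp_div_sinh_sq`). This is the source of the coefficients c_0 and c^±.

On the modes the equation couples conj X with Y and X with conj Y. The ansatz X = u t^λ, conj Y = v
t^λ solves it exactly when v(λ + iN) = u(c^+ - c_0) and u(λ - iN) = v conj(c^- - c_0), where N =
(2μ-1)/(2a). Hence it suffices that λ² = (c^+ - c_0) conj(c^- - c_0) - N². Noncollinearity says that
the right side is not real, so a root with Re λ > 0 exists. Since a determines g and μ, the growth
rate depends on M, a and α alone.

For large a, the noncollinearity is tested at α = 1/(2a). There the two differences, up to a common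
factor, have the same leading term as a → ∞, so the sign of the area is decided at the next order.
The limit is nonzero because sin 2φ < 2φ for φ = π/M. Continuity in α then covers a neighbourhood.
-/

/-! ### Hadamard finite parts: linearity and the model singularities -/

namespace HasFinitePart

variable {F F₁ F₂ : ℝ → ℂ} {a b x : ℝ} {L L₁ L₂ : ℂ}

theorem add (h₁ : HasFinitePart F₁ a b x L₁) (h₂ : HasFinitePart F₂ a b x L₂) :
    HasFinitePart (fun t => F₁ t + F₂ t) a b x (L₁ + L₂) := by
  refine ⟨?_, ?_⟩
  · filter_upwards [h₁.1, h₂.1] with ε e₁ e₂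
    exact ⟨e₁.1.add e₂.1, e₁.2.add e₂.2⟩
  · refine (h₁.2.add h₂.2).congr' ?_
    filter_upwards [h₁.1, h₂.1] with ε e₁ e₂
    rw [intervalIntegral.integral_add e₁.1 e₂.1, intervalIntegral.integral_add e₁.2 e₂.2]
    ring

theorem const_mul (c : ℂ) (h : HasFinitePart F a b x L) :
    HasFinitePart (fun t => c * F t) a b x (c * L) := by
  refine ⟨?_, ?_⟩
  · filter_upwards [h.1] with ε e
    exact ⟨e.1.const_mul c, e.2.const_mul c⟩
  · refine (h.2.const_mul c).congr fun ε => ?_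
    rw [intervalIntegral.integral_const_mul, intervalIntegral.integral_const_mul]
    ring

theorem congr (h : HasFinitePart F₁ a b x L) (ha : a < x) (hb : x < b)
    (heq : ∀ t, t ≠ x → F₁ t = F₂ t) : HasFinitePart F₂ a b x L := by
  have key : ∀ᶠ ε : ℝ in 𝓝[>] 0, EqOn F₁ F₂ (uIcc a (x - ε)) ∧ EqOn F₁ F₂ (uIcc (x + ε) b) ∧
      F₁ (x + ε) = F₂ (x + ε) ∧ F₁ (x - ε) = F₂ (x - ε) := by
    filter_upwards [Ioo_mem_nhdsGT (show (0 : ℝ) < min (x - a) (b - x) by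
      simp only [lt_min_iff]; constructor <;> linarith)] with ε hε
    simp only [mem_Ioo, lt_min_iff] at hε
    rw [uIcc_of_le (by linarith), uIcc_of_le (by linarith)]
    refine ⟨fun t ht => heq t ?_, fun t ht => heq t ?_, heq _ ?_, heq _ ?_⟩
    · exact ne_of_lt (by linarith [ht.2])
    · exact ne_of_gt (by linarith [ht.1])
    · exact ne_of_gt (by linarith)
    · exact ne_of_lt (by linarith)
  refine ⟨?_, ?_⟩
  · filter_upwards [h.1, key] with ε e k
    exact ⟨e.1.congr (k.1.mono uIoc_subset_uIcc), e.2.congr (k.2.1.mono uIoc_subset_uIcc)⟩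
  · refine h.2.congr' ?_
    filter_upwards [key] with ε k
    rw [intervalIntegral.integral_congr k.1, intervalIntegral.integral_congr k.2.1, k.2.2.1, k.2.2.2]

/-- Both the removed interval and the correction term shrink to zero, so the finite part of a
regular function is its integral. -/
theorem of_continuous (hF : Continuous F) : HasFinitePart F a b x (∫ t in a..b, F t) := by
  refine ⟨Eventually.of_forall fun ε => ⟨hF.intervalIntegrable _ _, hF.intervalIntegrable _ _⟩, ?_⟩
  have h1 : ∀ ε : ℝ, (∫ t in a..(x - ε), F t) + (∫ t in (x + ε)..b, F t) =
      (∫ t in a..b, F t) - ∫ t in (x - ε)..(x + ε), F t := fun ε => by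
    rw [← intervalIntegral.integral_add_adjacent_intervals (hF.intervalIntegrable a (x - ε))
      (hF.intervalIntegrable (x - ε) b),
      ← intervalIntegral.integral_add_adjacent_intervals (hF.intervalIntegrable (x - ε) (x + ε))
      (hF.intervalIntegrable (x + ε) b)]
    ring
  have hprim : Continuous fun u : ℝ => ∫ t in x..u, F t :=
    intervalIntegral.continuous_primitive (fun _ _ => hF.intervalIntegrable _ _) x
  have hc : Continuous fun ε : ℝ =>
      (∫ t in a..b, F t) - ((∫ t in x..(x + ε), F t) - ∫ t in x..(x - ε), F t)
        - (ε : ℂ) * (F (x + ε) + F (x - ε)) := by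
    have h2 := hprim.comp (continuous_const.add continuous_id : Continuous fun ε : ℝ => x + ε)
    have h3 := hprim.comp (continuous_const.sub continuous_id : Continuous fun ε : ℝ => x - ε)
    simp only [Function.comp_def] at h2 h3
    fun_prop
  have ht := hc.tendsto 0
  simp only [add_zero, sub_zero, intervalIntegral.integral_same, sub_self, Complex.ofReal_zero,
    zero_mul] at ht
  refine (ht.mono_left nhdsWithin_le_nhds).congr fun ε => ?_
  rw [h1, intervalIntegral.integral_interval_sub_left (hF.intervalIntegrable _ _)
    (hF.intervalIntegrable _ _)]

theorem inv {r s : ℝ} (hr : 0 < r) (hs : 0 < s) :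
    HasFinitePart (fun t : ℝ => (t : ℂ)⁻¹) (-r) s 0 (Real.log s - Real.log r : ℝ) := by
  have hev : ∀ᶠ ε : ℝ in 𝓝[>] 0, ε ∈ Ioo 0 (min r s) := Ioo_mem_nhdsGT (lt_min hr hs)
  have hI : ∀ u v : ℝ, (∫ t in u..v, (t : ℂ)⁻¹) = ((∫ t in u..v, t⁻¹ : ℝ) : ℂ) := fun u v => by
    rw [← intervalIntegral.integral_ofReal]; simp
  refine ⟨?_, tendsto_const_nhds.congr' ?_⟩
  · filter_upwards [hev] with ε hε
    simp only [mem_Ioo, lt_min_iff] at hε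
    have : ∀ u v : ℝ, (∀ t ∈ uIcc u v, t ≠ 0) →
        IntervalIntegrable (fun t : ℝ => (t : ℂ)⁻¹) volume u v := fun u v h =>
      (ContinuousOn.inv₀ (by fun_prop) fun t ht => by exact_mod_cast h t ht).intervalIntegrable
    constructor <;> apply this
    · rw [uIcc_of_le (by linarith)]
      exact fun t ht => ne_of_lt (by linarith [ht.2])
    · rw [uIcc_of_le (by linarith)]
      exact fun t ht => ne_of_gt (by linarith [ht.1])
  -- Oddness kills the correction term, and the two log ε cancel: the expression is already constant
  -- for small ε.
  · filter_upwards [hev] with ε hε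
    simp only [mem_Ioo, lt_min_iff] at hε
    rw [hI, hI, integral_inv_of_neg (by linarith) (by linarith), integral_inv_of_pos (by linarith) hs]
    have e1 : (0 - ε) / -r = ε / r := by rw [zero_sub, neg_div_neg_eq]
    rw [e1, zero_add, Real.log_div hε.1.ne' hr.ne', Real.log_div hs.ne' hε.1.ne']
    push_cast
    simp

theorem inv_sq {r s : ℝ} (hr : 0 < r) (hs : 0 < s) :
    HasFinitePart (fun t : ℝ => ((t : ℂ) ^ 2)⁻¹) (-r) s 0 (-r⁻¹ - s⁻¹ : ℝ) := by
  have hev : ∀ᶠ ε : ℝ in 𝓝[>] 0, ε ∈ Ioo 0 (min r s) := Ioo_mem_nhdsGT (lt_min hr hs)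
  have hint : ∀ u v : ℝ, (∀ t ∈ uIcc u v, t ≠ 0) →
      IntervalIntegrable (fun t : ℝ => ((t : ℂ) ^ 2)⁻¹) volume u v := fun u v h =>
    (ContinuousOn.inv₀ (by fun_prop) fun t ht => by
      exact pow_ne_zero 2 (by exact_mod_cast h t ht)).intervalIntegrable
  have hI : ∀ u v : ℝ, (∀ t ∈ uIcc u v, t ≠ 0) →
      (∫ t in u..v, ((t : ℂ) ^ 2)⁻¹) = -(v : ℂ)⁻¹ - -(u : ℂ)⁻¹ := fun u v h => by
    refine intervalIntegral.integral_eq_sub_of_hasDerivAt (f := fun t : ℝ => -(t : ℂ)⁻¹)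
      (fun t ht => ?_) (hint u v h)
    have h0 : (t : ℂ) ≠ 0 := by exact_mod_cast h t ht
    simpa using ((hasDerivAt_inv h0).neg).comp_ofReal
  have hn : ∀ ε : ℝ, ε ∈ Ioo 0 (min r s) →
      (∀ t ∈ uIcc (-r) (0 - ε), t ≠ 0) ∧ (∀ t ∈ uIcc (0 + ε) s, t ≠ 0) := fun ε hε => by
    simp only [mem_Ioo, lt_min_iff] at hε
    rw [uIcc_of_le (by linarith), uIcc_of_le (by linarith)]
    exact ⟨fun t ht => ne_of_lt (by linarith [ht.2]), fun t ht => ne_of_gt (by linarith [ht.1])⟩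
  refine ⟨?_, tendsto_const_nhds.congr' ?_⟩
  · filter_upwards [hev] with ε hε
    exact ⟨hint _ _ (hn ε hε).1, hint _ _ (hn ε hε).2⟩
  -- The boundary terms at ±ε add up to 2/ε, which is exactly the subtracted correction.
  · filter_upwards [hev] with ε hε
    rw [hI _ _ (hn ε hε).1, hI _ _ (hn ε hε).2]
    have h0 : (ε : ℂ) ≠ 0 := by exact_mod_cast hε.1.ne'
    have h1 : (r : ℂ) ≠ 0 := by exact_mod_cast hr.ne'
    have h2 : (s : ℂ) ≠ 0 := by exact_mod_cast hs.ne'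
    push_cast
    simp only [zero_sub, zero_add]
    field_simp
    ring

end HasFinitePart

namespace HasImproperFinitePart

variable {F F₁ F₂ : ℝ → ℂ} {L L₁ L₂ : ℂ}

theorem add (h₁ : HasImproperFinitePart F₁ L₁) (h₂ : HasImproperFinitePart F₂ L₂) :
    HasImproperFinitePart (fun t => F₁ t + F₂ t) (L₁ + L₂) := by
  obtain ⟨G₁, hG₁, ht₁⟩ := h₁
  obtain ⟨G₂, hG₂, ht₂⟩ := h₂
  exact ⟨fun r s => G₁ r s + G₂ r s, fun r s hr hs => (hG₁ r s hr hs).add (hG₂ r s hr hs),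
    ht₁.add ht₂⟩

theorem const_mul (c : ℂ) (h : HasImproperFinitePart F L) :
    HasImproperFinitePart (fun t => c * F t) (c * L) := by
  obtain ⟨G, hG, ht⟩ := h
  exact ⟨fun r s => c * G r s, fun r s hr hs => (hG r s hr hs).const_mul c, ht.const_mul c⟩

theorem congr (h : HasImproperFinitePart F₁ L) (heq : ∀ t, t ≠ 0 → F₁ t = F₂ t) :
    HasImproperFinitePart F₂ L := by
  obtain ⟨G, hG, ht⟩ := h
  exact ⟨G, fun r s hr hs => (hG r s hr hs).congr (by linarith) hs heq, ht⟩

end HasImproperFinitePart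

/-! ### Integrals along a horizontal line off the real axis -/

theorem integrable_of_continuous_of_exp_decay {f : ℝ → ℂ} (hf : Continuous f) {K δ R : ℝ}
    (hδ : 0 < δ) (hb : ∀ x : ℝ, R ≤ |x| → ‖f x‖ ≤ K * Real.exp (-δ * |x|)) :
    Integrable f := by
  have hR : ∀ x : ℝ, |R| ≤ |x| → ‖f x‖ ≤ K * Real.exp (-δ * |x|) :=
    fun x hx => hb x ((le_abs_self R).trans hx)
  have h1 : IntegrableOn f (Iic (-|R|)) := by
    refine Integrable.mono' ((integrableOn_exp_mul_Iic hδ (-|R|)).const_mul K)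
      hf.aestronglyMeasurable ?_
    filter_upwards [ae_restrict_mem measurableSet_Iic] with x hx
    have hx0 : x ≤ 0 := (mem_Iic.1 hx).trans (by simp)
    have := hR x (by rw [abs_of_nonpos hx0]; linarith [mem_Iic.1 hx])
    rwa [abs_of_nonpos hx0, neg_mul_neg] at this
  have h2 : IntegrableOn f (Ioi |R|) := by
    refine Integrable.mono' ((integrableOn_exp_mul_Ioi (neg_lt_zero.2 hδ) |R|).const_mul K)
      hf.aestronglyMeasurable ?_
    filter_upwards [ae_restrict_mem measurableSet_Ioi] with x hx
    have hx0 : 0 ≤ x := (abs_nonneg R).trans (mem_Ioi.1 hx).le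
    have := hR x (by rw [abs_of_nonneg hx0]; exact (mem_Ioi.1 hx).le)
    rwa [abs_of_nonneg hx0] at this
  have h3 : IntegrableOn f (Icc (-|R|) |R|) := hf.continuousOn.integrableOn_Icc
  rw [← integrableOn_univ]
  refine ((h1.union h3).union h2).mono_set fun x _ => ?_
  simp only [mem_union, mem_Iic, mem_Icc, mem_Ioi]
  rcases le_or_gt x (-|R|) with h | h
  · exact Or.inl (Or.inl h)
  · rcases le_or_gt x |R| with h' | h'
    · exact Or.inl (Or.inr ⟨h.le, h'⟩)
    · exact Or.inr h'

theorem add_mul_I_ne_zero {x h : ℝ} (hh : h ≠ 0) : (x : ℂ) + h * Complex.I ≠ 0 := fun h0 => by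
  have := congrArg Complex.im h0
  simp at this
  exact hh this

theorem continuous_add_mul_I_inv {h : ℝ} (hh : h ≠ 0) :
    Continuous fun x : ℝ => ((x : ℂ) + h * Complex.I)⁻¹ :=
  Continuous.inv₀ (by fun_prop) fun _ => add_mul_I_ne_zero hh

theorem continuous_add_mul_I_sq_inv {h : ℝ} (hh : h ≠ 0) :
    Continuous fun x : ℝ => (((x : ℂ) + h * Complex.I) ^ 2)⁻¹ :=
  Continuous.inv₀ (by fun_prop) fun _ => pow_ne_zero 2 (add_mul_I_ne_zero hh)

theorem integral_add_mul_I_sq_inv {h : ℝ} (hh : h ≠ 0) (u v : ℝ) :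
    ∫ x in u..v, (((x : ℂ) + h * Complex.I) ^ 2)⁻¹ =
      -((v : ℂ) + h * Complex.I)⁻¹ + ((u : ℂ) + h * Complex.I)⁻¹ := by
  rw [intervalIntegral.integral_eq_sub_of_hasDerivAt
    (f := fun x : ℝ => -((x : ℂ) + h * Complex.I)⁻¹) (fun x _ => ?_)
    ((continuous_add_mul_I_sq_inv hh).intervalIntegrable _ _)]
  · ring
  · have h1 : HasDerivAt (fun x : ℝ => (x : ℂ) + h * Complex.I) 1 x :=
      (Complex.ofRealCLM.hasDerivAt).add_const _
    exact (h1.inv (add_mul_I_ne_zero hh)).neg.congr_deriv (by rw [neg_div, neg_neg, one_div])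

/-- The primitive is a logarithm of x + ih written through real log and arctan, which avoids branch
cuts for either sign of h. -/
theorem integral_add_mul_I_inv {h : ℝ} (hh : h ≠ 0) (u v : ℝ) :
    ∫ x in u..v, ((x : ℂ) + h * Complex.I)⁻¹ =
      ((Real.log (v ^ 2 + h ^ 2) / 2 - Real.log (u ^ 2 + h ^ 2) / 2 : ℝ) : ℂ)
        - Complex.I * ((Real.arctan (v / h) - Real.arctan (u / h) : ℝ) : ℂ) := by
  rw [intervalIntegral.integral_eq_sub_of_hasDerivAt
    (f := fun x : ℝ => ((Real.log (x ^ 2 + h ^ 2) / 2 : ℝ) : ℂ)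
      - Complex.I * ((Real.arctan (x / h) : ℝ) : ℂ)) (fun x _ => ?_)
    ((continuous_add_mul_I_inv hh).intervalIntegrable _ _)]
  · push_cast; ring
  · have hpos : 0 < x ^ 2 + h ^ 2 := by positivity
    have h1 : HasDerivAt (fun x : ℝ => Real.log (x ^ 2 + h ^ 2) / 2) (2 * x / (x ^ 2 + h ^ 2) / 2) x := by
      have := (((hasDerivAt_pow 2 x).add_const (h ^ 2)).log hpos.ne').div_const 2
      simpa using this
    have h2 : HasDerivAt (fun x : ℝ => Real.arctan (x / h)) (1 / (1 + (x / h) ^ 2) * (1 / h)) x :=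
      ((hasDerivAt_id x).div_const h).arctan
    refine (h1.ofReal_comp.sub (h2.ofReal_comp.const_mul Complex.I)).congr_deriv ?_
    have hne := add_mul_I_ne_zero (x := x) hh
    have hc : (h : ℂ) ≠ 0 := by exact_mod_cast hh
    have hpc : (x : ℂ) ^ 2 + (h : ℂ) ^ 2 ≠ 0 := by exact_mod_cast hpos.ne'
    have hpc' : (h : ℂ) ^ 2 + (x : ℂ) ^ 2 ≠ 0 := by rwa [add_comm]
    push_cast
    have e1 : (1 : ℂ) / (1 + (x / h) ^ 2) * (1 / h) = h / (x ^ 2 + h ^ 2) := by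
      field_simp
      ring
    rw [e1]
    field_simp
    linear_combination (-(h : ℂ) ^ 2) * Complex.I_sq

theorem tendsto_log_sub_half_log_sq_add (h : ℝ) :
    Tendsto (fun s : ℝ => Real.log s - Real.log (s ^ 2 + h ^ 2) / 2) atTop (𝓝 0) := by
  have h1 : Tendsto (fun s : ℝ => -(Real.log (1 + h ^ 2 * (s⁻¹) ^ 2) / 2)) atTop (𝓝 0) := by
    have : Tendsto (fun s : ℝ => 1 + h ^ 2 * (s⁻¹) ^ 2) atTop (𝓝 (1 + h ^ 2 * 0 ^ 2)) :=
      ((tendsto_inv_atTop_zero.pow 2).const_mul _).const_add _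
    have h2 := ((this.log (by norm_num)).div_const 2).neg
    simpa using h2
  refine h1.congr' ?_
  filter_upwards [eventually_gt_atTop 0] with s hs
  have : s ^ 2 + h ^ 2 = s ^ 2 * (1 + h ^ 2 * (s⁻¹) ^ 2) := by field_simp
  rw [this, Real.log_mul (by positivity) (by positivity), Real.log_pow]
  push_cast
  ring

theorem tendsto_add_mul_I_inv (h : ℝ) {f : ℝ → ℝ} (hf : Tendsto (fun x => |f x|) atTop atTop) :
    Tendsto (fun x : ℝ => ((f x : ℂ) + h * Complex.I)⁻¹) atTop (𝓝 0) := by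
  rw [tendsto_zero_iff_norm_tendsto_zero]
  refine squeeze_zero' (Eventually.of_forall fun _ => norm_nonneg _) ?_
    (tendsto_inv_atTop_zero.comp hf)
  filter_upwards [hf.eventually_gt_atTop 0] with x hx
  rw [norm_inv]
  refine inv_anti₀ hx ?_
  simpa using Complex.abs_re_le_norm ((f x : ℂ) + h * Complex.I)

/-! ### Shifting the contour of a finite part -/

noncomputable section

/-- The finite part over `[-r, s]` of `r₂ / z² + r₁ / z + H z`. -/
def laurentFinitePart (H : ℂ → ℂ) (r₁ r₂ : ℂ) (r s : ℝ) : ℂ :=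
  r₂ * (-r⁻¹ - s⁻¹ : ℝ) + r₁ * (Real.log s - Real.log r : ℝ) + ∫ t in (-r)..s, H t

theorem hasFinitePart_laurent {F : ℝ → ℂ} {H : ℂ → ℂ} {r₁ r₂ : ℂ} {r s : ℝ} (hr : 0 < r)
    (hs : 0 < s) (hH : Continuous fun t : ℝ => H t)
    (hF : ∀ t : ℝ, t ≠ 0 → F t = r₂ * ((t : ℂ) ^ 2)⁻¹ + r₁ * (t : ℂ)⁻¹ + H t) :
    HasFinitePart F (-r) s 0 (laurentFinitePart H r₁ r₂ r s) :=
  ((((HasFinitePart.inv_sq hr hs).const_mul r₂).add ((HasFinitePart.inv hr hs).const_mul r₁)).add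
    (HasFinitePart.of_continuous hH)).congr (by linarith) hs fun t ht => (hF t ht).symm

theorem mem_strip_of_uIcc {h y : ℝ} (hy : y ∈ uIcc 0 h) : |y| ≤ |h| := by
  rcases le_total 0 h with h0 | h0
  · rw [uIcc_of_le h0] at hy
    rw [abs_of_nonneg hy.1, abs_of_nonneg h0]; exact hy.2
  · rw [uIcc_of_ge h0] at hy
    rw [abs_of_nonpos hy.2, abs_of_nonpos h0]; linarith [hy.1]

/-- The regular part H does not inherit the exponential decay of F, but it differs from F only by
the two polar terms, which also tend to zero on distant vertical sides. -/
theorem tendsto_vertical_integral {F H : ℂ → ℂ} {r₁ r₂ : ℂ} {h K δ R : ℝ} (hδ : 0 < δ)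
    (hF : ∀ z : ℂ, |z.im| ≤ |h| → z ≠ 0 → F z = r₂ * (z ^ 2)⁻¹ + r₁ * z⁻¹ + H z)
    (hb : ∀ x y : ℝ, R ≤ |x| → |y| ≤ |h| →
      ‖F (x + y * Complex.I)‖ ≤ K * Real.exp (-δ * |x|))
    {f : ℝ → ℝ} (hf : Tendsto (fun x => |f x|) atTop atTop) :
    Tendsto (fun x : ℝ => ∫ y in (0 : ℝ)..h, H ((f x : ℂ) + y * Complex.I)) atTop (𝓝 0) := by
  have hlim : Tendsto (fun x : ℝ =>
      (K * Real.exp (-δ * x) + ‖r₂‖ * (x⁻¹) ^ 2 + ‖r₁‖ * x⁻¹) * |h - 0|) atTop (𝓝 0) := by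
    have e : Tendsto (fun x : ℝ => Real.exp (-δ * x)) atTop (𝓝 0) :=
      Real.tendsto_exp_atBot.comp
        (Tendsto.const_mul_atTop_of_neg (neg_lt_zero.2 hδ) tendsto_id)
    have := ((((e.const_mul K).add ((tendsto_inv_atTop_zero.pow 2).const_mul ‖r₂‖)).add
      (tendsto_inv_atTop_zero.const_mul ‖r₁‖)).mul_const |h - 0|)
    simpa using this
  rw [tendsto_zero_iff_norm_tendsto_zero]
  refine squeeze_zero' (Eventually.of_forall fun _ => norm_nonneg _) ?_ (hlim.comp hf)
  filter_upwards [hf.eventually_gt_atTop 0, hf.eventually_ge_atTop R] with x hx hxR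
  refine intervalIntegral.norm_integral_le_of_norm_le_const fun y hy => ?_
  have hy' := mem_strip_of_uIcc (uIoc_subset_uIcc hy)
  set z : ℂ := (f x : ℂ) + y * Complex.I with hz
  have hre : |f x| ≤ ‖z‖ := by simpa [hz] using Complex.abs_re_le_norm z
  have hz0 : z ≠ 0 := norm_pos_iff.1 (hx.trans_le hre)
  have hHz : H z = F z - r₂ * (z ^ 2)⁻¹ - r₁ * z⁻¹ := by
    rw [hF z (by simpa [hz] using hy') hz0]; ring
  rw [hHz]
  have hinv : ‖z⁻¹‖ ≤ |f x|⁻¹ := by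
    rw [norm_inv]; exact inv_anti₀ hx hre
  refine (norm_sub_le _ _).trans (add_le_add ((norm_sub_le _ _).trans
    (add_le_add (hb _ _ hxR hy') ?_)) ?_)
  · rw [norm_mul, ← inv_pow, norm_pow]; gcongr
  · rw [norm_mul]; gcongr

/-- Cauchy's theorem on a rectangle is applied to H only; the polar terms are integrated explicitly
on both horizontal sides. With κ = ±π/2, according to the sign of h, the extra term is ±πi r₁, half
a residue. -/
theorem tendsto_laurentFinitePart {F H : ℂ → ℂ} {r₁ r₂ : ℂ} {h K δ R κ : ℝ} (hh : h ≠ 0)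
    (hδ : 0 < δ) (hH : DifferentiableOn ℂ H {z | |z.im| ≤ |h|})
    (hF : ∀ z : ℂ, |z.im| ≤ |h| → z ≠ 0 → F z = r₂ * (z ^ 2)⁻¹ + r₁ * z⁻¹ + H z)
    (hb : ∀ x y : ℝ, R ≤ |x| → |y| ≤ |h| →
      ‖F (x + y * Complex.I)‖ ≤ K * Real.exp (-δ * |x|))
    (hκ : Tendsto (fun x : ℝ => Real.arctan (x / h)) atTop (𝓝 κ)) :
    Tendsto (fun p : ℝ × ℝ => laurentFinitePart H r₁ r₂ p.1 p.2) (atTop ×ˢ atTop)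
      (𝓝 ((∫ x : ℝ, F (x + h * Complex.I)) + r₁ * (2 * κ * Complex.I))) := by
  have hHc : Continuous fun x : ℝ => H (x + h * Complex.I) :=
    continuousOn_univ.1 <| hH.continuousOn.comp
      (f := fun x : ℝ => (x : ℂ) + h * Complex.I) (by fun_prop) fun x _ => by simp
  have hFeq : ∀ x : ℝ, F (x + h * Complex.I) = r₂ * ((x + h * Complex.I : ℂ) ^ 2)⁻¹
      + r₁ * (x + h * Complex.I : ℂ)⁻¹ + H (x + h * Complex.I) := fun x =>
    hF _ (by simp) (add_mul_I_ne_zero hh)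
  have hc2 := continuous_add_mul_I_sq_inv hh
  have hc1 := continuous_add_mul_I_inv hh
  have hFc : Continuous fun x : ℝ => F (x + h * Complex.I) := by
    simp only [hFeq]
    exact ((hc2.const_mul _).add (hc1.const_mul _)).add hHc
  have hFi : Integrable fun x : ℝ => F (x + h * Complex.I) :=
    integrable_of_continuous_of_exp_decay hFc hδ fun x hx => hb x h hx le_rfl
  have hT1 : Tendsto (fun p : ℝ × ℝ => ∫ x in (-p.1)..p.2, F (x + h * Complex.I))
      (atTop ×ˢ atTop) (𝓝 (∫ x : ℝ, F (x + h * Complex.I))) :=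
    intervalIntegral_tendsto_integral hFi (tendsto_neg_atTop_atBot.comp tendsto_fst) tendsto_snd
  have habs : Tendsto (fun x : ℝ => |x|) atTop atTop := tendsto_abs_atTop_atTop
  have habs' : Tendsto (fun x : ℝ => |-x|) atTop atTop := by simpa using habs
  have hV1 := (tendsto_vertical_integral hδ hF hb habs).comp
    (tendsto_snd (f := (atTop : Filter ℝ)) (g := (atTop : Filter ℝ)))
  have hV2 := (tendsto_vertical_integral hδ hF hb habs').comp
    (tendsto_fst (f := (atTop : Filter ℝ)) (g := (atTop : Filter ℝ)))
  have hI1 := (tendsto_add_mul_I_inv h habs).comp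
    (tendsto_snd (f := (atTop : Filter ℝ)) (g := (atTop : Filter ℝ)))
  have hI2 := (tendsto_add_mul_I_inv h habs').comp
    (tendsto_fst (f := (atTop : Filter ℝ)) (g := (atTop : Filter ℝ)))
  have hinv : Tendsto (fun x : ℝ => ((x⁻¹ : ℝ) : ℂ)) atTop (𝓝 0) := by
    exact Complex.ofReal_zero ▸ (Complex.continuous_ofReal.tendsto 0).comp tendsto_inv_atTop_zero
  have hJ1 := hinv.comp (tendsto_snd (f := (atTop : Filter ℝ)) (g := (atTop : Filter ℝ)))
  have hJ2 := hinv.comp (tendsto_fst (f := (atTop : Filter ℝ)) (g := (atTop : Filter ℝ)))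
  have hlog : Tendsto (fun s : ℝ => ((Real.log s - Real.log (s ^ 2 + h ^ 2) / 2 : ℝ) : ℂ)) atTop
      (𝓝 0) := by
    exact Complex.ofReal_zero ▸ (Complex.continuous_ofReal.tendsto 0).comp (tendsto_log_sub_half_log_sq_add h)
  have hl1 := hlog.comp (tendsto_snd (f := (atTop : Filter ℝ)) (g := (atTop : Filter ℝ)))
  have hl2 := hlog.comp (tendsto_fst (f := (atTop : Filter ℝ)) (g := (atTop : Filter ℝ)))
  have hκ' : Tendsto (fun s : ℝ => ((Real.arctan (s / h) : ℝ) : ℂ)) atTop (𝓝 κ) :=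
    (Complex.continuous_ofReal.tendsto κ).comp hκ
  have ha1 := hκ'.comp (tendsto_snd (f := (atTop : Filter ℝ)) (g := (atTop : Filter ℝ)))
  have ha2 := hκ'.comp (tendsto_fst (f := (atTop : Filter ℝ)) (g := (atTop : Filter ℝ)))
  -- The r₁ terms are grouped so that each logarithm is paired with its counterpart on the shifted
  -- line; separately they diverge as r and s tend to infinity independently.
  have hall := (((hT1.sub (hV1.const_mul Complex.I)).add (hV2.const_mul Complex.I)).add
    ((((hJ2.neg.sub hJ1).add hI1).sub hI2).const_mul r₂)).add
    (((hl1.sub hl2).add ((ha1.add ha2).const_mul Complex.I)).const_mul r₁)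
  simp only [Function.comp_def] at hall
  have hval : (∫ x : ℝ, F (x + h * Complex.I)) - Complex.I * 0 + Complex.I * 0
      + r₂ * (-0 - 0 + 0 - 0) + r₁ * (0 - 0 + Complex.I * (κ + κ)) =
      (∫ x : ℝ, F (x + h * Complex.I)) + r₁ * (2 * κ * Complex.I) := by ring
  rw [hval] at hall
  refine hall.congr fun p => ?_
  obtain ⟨r, s⟩ := p
  have hrect := Complex.integral_boundary_rect_eq_zero_of_differentiableOn H
    ((-r : ℝ) : ℂ) (s + h * Complex.I) (hH.mono fun z hz => by
      have h2 := (Complex.mem_reProdIm.1 hz).2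
      simp only [Complex.ofReal_im, Complex.add_im, Complex.mul_im, Complex.ofReal_re,
        Complex.I_im, mul_one, Complex.I_re, mul_zero, add_zero, zero_add] at h2
      exact mem_strip_of_uIcc h2)
  simp at hrect
  have hHF : (∫ x in (-r)..s, H (x + h * Complex.I)) = (∫ x in (-r)..s, F (x + h * Complex.I))
      - r₂ * (∫ x in (-r)..s, (((x : ℂ) + h * Complex.I) ^ 2)⁻¹)
      - r₁ * ∫ x in (-r)..s, ((x : ℂ) + h * Complex.I)⁻¹ := by
    have hsum : (∫ x in (-r)..s, F (x + h * Complex.I)) =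
        ∫ x in (-r)..s, ((r₂ * (((x : ℂ) + h * Complex.I) ^ 2)⁻¹
          + r₁ * ((x : ℂ) + h * Complex.I)⁻¹) + H (x + h * Complex.I)) :=
      intervalIntegral.integral_congr fun x _ => hFeq x
    have hc21 : Continuous fun x : ℝ => r₂ * (((x : ℂ) + h * Complex.I) ^ 2)⁻¹
        + r₁ * ((x : ℂ) + h * Complex.I)⁻¹ := (hc2.const_mul _).add (hc1.const_mul _)
    rw [hsum, intervalIntegral.integral_add (hc21.intervalIntegrable _ _)
        (hHc.intervalIntegrable _ _),
      intervalIntegral.integral_add ((hc2.const_mul _).intervalIntegrable _ _)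
        ((hc1.const_mul _).intervalIntegrable _ _),
      intervalIntegral.integral_const_mul, intervalIntegral.integral_const_mul]
    ring
  rw [hHF, integral_add_mul_I_sq_inv hh, integral_add_mul_I_inv hh, neg_div, Real.arctan_neg] at hrect
  simp only [laurentFinitePart]
  push_cast at hrect ⊢
  simp only [neg_sq] at hrect
  linear_combination -hrect

end

/-! ### The finite part of an exponential over a squared hyperbolic sine -/

theorem sinh_eq_zero_exists_int {w : ℂ} (hw : Complex.sinh w = 0) :
    ∃ n : ℤ, w = n * (Real.pi * Complex.I) := by
  have h1 : Complex.exp (2 * w) = 1 := by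
    have h2 : Complex.exp w - Complex.exp (-w) = 0 := by
      rw [Complex.sinh, div_eq_zero_iff] at hw
      simpa using hw
    have h3 : Complex.exp (2 * w) = Complex.exp w * Complex.exp w := by
      rw [← Complex.exp_add]; ring_nf
    have h4 : Complex.exp w * Complex.exp (-w) = 1 := by rw [← Complex.exp_add]; simp
    linear_combination h3 + Complex.exp w * h2 + h4
  obtain ⟨n, hn⟩ := Complex.exp_eq_one_iff.1 h1
  exact ⟨n, by linear_combination hn / 2⟩

/-- The zeros are nπi/l, with imaginary part nπ Re l/|l|²; the strip keeps only n = 0. -/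
theorem sinh_mul_ne_zero_of_abs_im_lt {l z : ℂ} (hl : 0 < l.re)
    (hz : |z.im| < Real.pi * l.re / Complex.normSq l) (hz0 : z ≠ 0) :
    Complex.sinh (l * z) ≠ 0 := by
  intro h
  obtain ⟨n, hn⟩ := sinh_eq_zero_exists_int h
  have hl0 : l ≠ 0 := fun h0 => by simp [h0] at hl
  have hzn : z = n * (Real.pi * Complex.I) * l⁻¹ := by rw [← hn]; field_simp
  have him : z.im = n * (Real.pi * l.re / Complex.normSq l) := by
    rw [hzn]
    simp [Complex.inv_re, Complex.inv_im]
    ring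
  have hT : 0 < Real.pi * l.re / Complex.normSq l := by
    have := Complex.normSq_pos.2 hl0
    have := Real.pi_pos
    positivity
  rw [him, abs_mul, abs_of_pos hT] at hz
  have hn1 : |(n : ℝ)| < 1 := by
    by_contra hcon
    push Not at hcon
    nlinarith
  have hn0 : n = 0 := by
    rw [← Int.cast_abs] at hn1
    exact Int.abs_lt_one_iff.1 (by exact_mod_cast hn1)
  exact hz0 (by rw [hzn, hn0]; simp)

theorem deriv_zero_of_even {f : ℂ → ℂ} (hf : ∀ z, f (-z) = f z) : deriv f 0 = 0 := by
  have h1 : deriv (fun z => f (-z)) 0 = -deriv f (-0) := deriv_comp_neg f 0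
  simp only [hf, neg_zero] at h1
  linear_combination h1 / 2

/-- Dividing sinh(lz) by z leaves an even function, nonvanishing in the strip, with value l and
derivative 0 at the origin. The residue therefore comes from the exponential alone, and H is a
second divided difference. -/
theorem exists_laurent_exp_div_sinh_sq (l p : ℂ) (hl : 0 < l.re) :
    ∃ H : ℂ → ℂ, DifferentiableOn ℂ H {z | |z.im| < Real.pi * l.re / Complex.normSq l} ∧
      ∀ z : ℂ, |z.im| < Real.pi * l.re / Complex.normSq l → z ≠ 0 →
        Complex.exp (p * z) / Complex.sinh (l * z) ^ 2 =
          (l ^ 2)⁻¹ * (z ^ 2)⁻¹ + p / l ^ 2 * z⁻¹ + H z := by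
  have hl0 : l ≠ 0 := fun h0 => by simp [h0] at hl
  set U : Set ℂ := {z | |z.im| < Real.pi * l.re / Complex.normSq l} with hU
  have hUo : IsOpen U := isOpen_lt (by fun_prop) continuous_const
  have h0U : (0 : ℂ) ∈ U := by
    have := Complex.normSq_pos.2 hl0
    have := Real.pi_pos
    simp only [hU, mem_ofPred_eq, Complex.zero_im, abs_zero]
    positivity
  have hUn : U ∈ 𝓝 (0 : ℂ) := hUo.mem_nhds h0U
  set φ : ℂ → ℂ := dslope (fun z => Complex.sinh (l * z)) 0 with hφ
  have hderiv : HasDerivAt (fun z : ℂ => Complex.sinh (l * z)) l 0 := by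
    simpa using ((hasDerivAt_id (0 : ℂ)).const_mul l).csinh
  have hφ0 : φ 0 = l := by rw [hφ, dslope_same, hderiv.deriv]
  have hφz : ∀ z, Complex.sinh (l * z) = z * φ z := fun z => by
    have := sub_smul_dslope (fun z => Complex.sinh (l * z)) 0 z
    simpa using this.symm
  have hφd : Differentiable ℂ φ := by
    rw [← differentiableOn_univ, hφ, Complex.differentiableOn_dslope univ_mem]
    fun_prop
  have hφne : ∀ z ∈ U, φ z ≠ 0 := fun z hz => by
    rcases eq_or_ne z 0 with rfl | h0
    · rwa [hφ0]
    · have := sinh_mul_ne_zero_of_abs_im_lt hl hz h0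
      rw [hφz] at this
      exact right_ne_zero_of_mul this
  have hφ' : deriv φ 0 = 0 := by
    refine deriv_zero_of_even fun z => ?_
    rcases eq_or_ne z 0 with rfl | h0
    · simp
    · have h1 := hφz z
      have h2 := hφz (-z)
      rw [mul_neg, Complex.sinh_neg, h1] at h2
      exact mul_left_cancel₀ h0 (by linear_combination h2)
  set N : ℂ → ℂ := fun z => Complex.exp (p * z) / φ z ^ 2 with hN
  have hNd : DifferentiableOn ℂ N U := by
    refine DifferentiableOn.div (by fun_prop) (hφd.differentiableOn.pow 2) fun z hz => ?_
    exact pow_ne_zero 2 (hφne z hz)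
  have hN0 : N 0 = (l ^ 2)⁻¹ := by simp [hN, hφ0]
  have hN' : deriv N 0 = p / l ^ 2 := by
    have h1 : HasDerivAt (fun z : ℂ => Complex.exp (p * z)) p 0 := by
      simpa using ((hasDerivAt_id (0 : ℂ)).const_mul p).cexp
    have h2 : HasDerivAt φ 0 0 := by
      simpa only [hφ'] using (hφd 0).hasDerivAt
    have h3 := h1.div (h2.pow 2) (pow_ne_zero 2 (hφne 0 h0U))
    have h4 : HasDerivAt N (p / l ^ 2) 0 := by
      refine h3.congr_deriv ?_
      simp only [Pi.pow_apply, hφ0]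
      field_simp
      simp
    exact h4.deriv
  refine ⟨dslope (dslope N 0) 0, ?_, fun z hz hz0 => ?_⟩
  · rw [Complex.differentiableOn_dslope hUn, Complex.differentiableOn_dslope hUn]
    exact hNd
  · have h1 := sub_smul_dslope N 0 z
    have h2 := sub_smul_dslope (dslope N 0) 0 z
    simp only [sub_zero, smul_eq_mul, dslope_same, hN0, hN'] at h1 h2
    have h3 : Complex.exp (p * z) / Complex.sinh (l * z) ^ 2 = N z * (z ^ 2)⁻¹ := by
      rw [hφz, hN]
      have := hφne z hz
      field_simp
    rw [h3]
    have h4 : dslope (dslope N 0) 0 z = (dslope N 0 z - p / l ^ 2) * z⁻¹ := by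
      rw [← h2]; field_simp
    have h5 : dslope N 0 z = (N z - (l ^ 2)⁻¹) * z⁻¹ := by rw [← h1]; field_simp
    rw [h4, h5]
    field_simp
    ring

/-- The modulus is at least sinh |Re w|, and for x ≥ 1 the bounds e^x ≥ 2 and e^{-x} ≤ 1 give sinh x
≥ e^x/4. -/
theorem norm_sinh_ge {w : ℂ} (hw : 1 ≤ |w.re|) : Real.exp |w.re| / 4 ≤ ‖Complex.sinh w‖ := by
  have key : ∀ x : ℝ, 1 ≤ x → Real.exp x / 4 ≤ (Real.exp x - Real.exp (-x)) / 2 := fun x hx => by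
    have h1 : 2 ≤ Real.exp x := by linarith [Real.add_one_le_exp x]
    have h2 : Real.exp (-x) ≤ 1 := Real.exp_le_one_iff.2 (by linarith)
    linarith
  have h3 : ‖Complex.sinh w‖ = ‖Complex.exp w - Complex.exp (-w)‖ / 2 := by
    rw [Complex.sinh, norm_div]; simp
  refine (key _ hw).trans ?_
  rw [h3]
  rcases abs_cases w.re with ⟨h, _⟩ | ⟨h, _⟩
  · have := norm_sub_norm_le (Complex.exp w) (Complex.exp (-w))
    rw [Complex.norm_exp, Complex.norm_exp, Complex.neg_re] at this
    rw [h]; linarith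
  · have := norm_sub_norm_le (Complex.exp (-w)) (Complex.exp w)
    rw [Complex.norm_exp, Complex.norm_exp, Complex.neg_re, norm_sub_rev] at this
    rw [h, neg_neg]; linarith

theorem norm_exp_div_sinh_sq_le {l p : ℂ} (hl : 0 < l.re) {h x y : ℝ}
    (hx : (|l.im| * h + 1) / l.re ≤ |x|) (hy : |y| ≤ h) :
    ‖Complex.exp (p * (x + y * Complex.I)) / Complex.sinh (l * (x + y * Complex.I)) ^ 2‖ ≤
      16 * Real.exp (|p.im| * h + 2 * |l.im| * h) * Real.exp (-(2 * l.re - |p.re|) * |x|) := by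
  set w := l * (x + y * Complex.I) with hw
  have hwre : w.re = l.re * x - l.im * y := by simp [hw]
  have hpre : (p * (x + y * Complex.I)).re = p.re * x - p.im * y := by simp
  have hly : |l.im * y| ≤ |l.im| * h := by rw [abs_mul]; gcongr
  have hpy : |p.im * y| ≤ |p.im| * h := by rw [abs_mul]; gcongr
  have hpx : p.re * x ≤ |p.re| * |x| := by rw [← abs_mul]; exact le_abs_self _
  have hwge : l.re * |x| - |l.im| * h ≤ |w.re| := by
    have := abs_sub_abs_le_abs_sub (l.re * x) (l.im * y)
    rw [abs_mul, abs_of_pos hl] at this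
    rw [hwre]; linarith
  have h1 : 1 ≤ |w.re| := by
    rw [div_le_iff₀ hl] at hx
    linarith
  have h2 := norm_sinh_ge h1
  have h3 : (Real.exp (l.re * |x| - |l.im| * h) / 4) ^ 2 ≤ ‖Complex.sinh w‖ ^ 2 := by
    gcongr
    exact le_trans (by gcongr) h2
  rw [norm_div, norm_pow, Complex.norm_exp, hpre]
  calc Real.exp (p.re * x - p.im * y) / ‖Complex.sinh w‖ ^ 2
      ≤ Real.exp (|p.re| * |x| + |p.im| * h) / (Real.exp (l.re * |x| - |l.im| * h) / 4) ^ 2 := by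
        gcongr
        linarith [neg_abs_le (p.im * y)]
    _ = 16 * Real.exp (|p.im| * h + 2 * |l.im| * h) * Real.exp (-(2 * l.re - |p.re|) * |x|) := by
        rw [div_pow, ← Real.exp_nat_mul, div_div_eq_mul_div, div_eq_iff (Real.exp_pos _).ne',
          mul_assoc 16, mul_assoc 16, ← Real.exp_add, ← Real.exp_add]
        rw [mul_comm]
        norm_num
        ring

theorem hasImproperFinitePart_exp_div_sinh_sq {l p : ℂ} (hl : 0 < l.re)
    (hp : |p.re| < 2 * l.re) (he : Complex.exp (p * (Real.pi * Complex.I / l)) ≠ 1) :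
    HasImproperFinitePart (fun σ : ℝ => Complex.exp (p * σ) / Complex.sinh (l * σ) ^ 2)
      (-(Real.pi * Complex.I * p / l ^ 2 * ccoth (p * (Real.pi * Complex.I / l) / 2))) := by
  have hl0 : l ≠ 0 := fun h0 => by simp [h0] at hl
  have hnsq : 0 < Complex.normSq l := Complex.normSq_pos.2 hl0
  -- Half the distance to the nearest nonzero pole line, so that the lines Im z = ±h are pole-free
  -- and exactly Im T apart.
  set h : ℝ := Real.pi * l.re / Complex.normSq l / 2 with hh
  have hT : Real.pi * l.re / Complex.normSq l = 2 * h := by rw [hh]; ring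
  have hpos : 0 < h := by
    have := Real.pi_pos
    positivity
  set T : ℂ := Real.pi * Complex.I / l with hTdef
  have hTim : T.im = 2 * h := by
    rw [← hT, hTdef]
    simp [Complex.div_im]
  obtain ⟨H, hHd, hHF⟩ := exists_laurent_exp_div_sinh_sq l p hl
  rw [hT] at hHd hHF
  set F : ℂ → ℂ := fun z => Complex.exp (p * z) / Complex.sinh (l * z) ^ 2 with hF
  have hper : ∀ z, F (z + T) = Complex.exp (p * T) * F z := fun z => by
    have h1 : l * (z + T) = l * z + Real.pi * Complex.I := by rw [hTdef]; field_simp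
    simp only [hF]
    rw [h1, Complex.sinh_add_pi_mul_I, mul_add, Complex.exp_add, neg_sq]
    ring
  have hHd' : DifferentiableOn ℂ H {z | |z.im| ≤ h} := hHd.mono fun z hz => by
    simp only [mem_ofPred_eq] at hz ⊢
    linarith
  have hHF' : ∀ z : ℂ, |z.im| ≤ h → z ≠ 0 →
      F z = (l ^ 2)⁻¹ * (z ^ 2)⁻¹ + p / l ^ 2 * z⁻¹ + H z :=
    fun z hz hz0 => hHF z (by linarith) hz0
  have hb : ∀ x y : ℝ, (|l.im| * h + 1) / l.re ≤ |x| → |y| ≤ h →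
      ‖F (x + y * Complex.I)‖ ≤ 16 * Real.exp (|p.im| * h + 2 * |l.im| * h) *
        Real.exp (-(2 * l.re - |p.re|) * |x|) := fun x y hx hy =>
    norm_exp_div_sinh_sq_le hl hx hy
  have hδ : 0 < 2 * l.re - |p.re| := by linarith
  have habs : |h| = h := abs_of_pos hpos
  have habs' : |-h| = h := by rw [abs_neg, habs]
  have hat : Tendsto (fun x : ℝ => Real.arctan (x / h)) atTop (𝓝 (Real.pi / 2)) :=
    (Real.tendsto_arctan_atTop.mono_right nhdsWithin_le_nhds).comp
      (tendsto_id.atTop_div_const hpos)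
  have hat' : Tendsto (fun x : ℝ => Real.arctan (x / -h)) atTop (𝓝 (-(Real.pi / 2))) := by
    simpa [div_neg, Real.arctan_neg] using hat.neg
  have hup := tendsto_laurentFinitePart hpos.ne' hδ (habs.symm ▸ hHd') (habs.symm ▸ hHF')
    (habs.symm ▸ hb) hat
  have hlo := tendsto_laurentFinitePart (neg_ne_zero.2 hpos.ne') hδ (habs'.symm ▸ hHd')
    (habs'.symm ▸ hHF') (habs'.symm ▸ hb) hat'
  have heq := tendsto_nhds_unique hup hlo
  have hshift : (∫ x : ℝ, F (x + h * Complex.I)) =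
      Complex.exp (p * T) * ∫ x : ℝ, F (x + (-h : ℝ) * Complex.I) := by
    rw [← integral_const_mul]
    -- T is in general not purely imaginary; its real part is absorbed by translation invariance.
    rw [← integral_sub_right_eq_self (fun x : ℝ =>
      Complex.exp (p * T) * F (x + (-h : ℝ) * Complex.I)) T.re]
    refine integral_congr_ae (Eventually.of_forall fun x => ?_)
    simp only
    rw [← hper]
    congr 1
    have hTri : T = (T.re : ℂ) + ((2 * h : ℝ) : ℂ) * Complex.I := by
      rw [← hTim, Complex.re_add_im]
    push_cast at hTri ⊢
    linear_combination -hTri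
  rw [hshift] at heq
  set L := ∫ x : ℝ, F (x + (-h : ℝ) * Complex.I)
  refine ⟨fun r s => laurentFinitePart H (p / l ^ 2) (l ^ 2)⁻¹ r s, fun r s hr hs => ?_, ?_⟩
  · refine hasFinitePart_laurent hr hs ?_ fun t ht => ?_
    · exact continuousOn_univ.1 (hHd.continuousOn.comp (f := fun t : ℝ => (t : ℂ)) (by fun_prop)
        fun t _ => by simp [hpos])
    · exact hHF' t (by simp [hpos.le]) (by exact_mod_cast ht)
  · convert hlo using 2
    -- The two half residues have opposite signs, so their difference is one full residue.
    have hL : L * (Complex.exp (p * T) - 1) = -(2 * Real.pi * Complex.I * (p / l ^ 2)) := by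
      push_cast at heq
      linear_combination heq
    have h1 : Complex.exp (p * T) - 1 ≠ 0 := sub_ne_zero.2 he
    have hc : ccoth (p * T / 2) = (Complex.exp (p * T) + 1) / (Complex.exp (p * T) - 1) := by
      have e1 : Complex.exp (p * T) = Complex.exp (p * T / 2) * Complex.exp (p * T / 2) := by
        rw [← Complex.exp_add]; ring_nf
      have e2 : Complex.exp (p * T / 2) ≠ 0 := Complex.exp_ne_zero _
      rw [e1] at h1 ⊢
      rw [ccoth, Complex.cosh, Complex.sinh, Complex.exp_neg]
      field_simp
    rw [hc]
    push_cast
    rw [eq_div_of_mul_eq h1 hL]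
    field_simp
    ring

/-! ### Sums over the branches -/

/-- The sum is the square of 1 + u + … + u^{M-1} with exponents folded modulo M: u^j occurs j + 1
times and u^{M+j} occurs M - 1 - j times. -/
theorem one_sub_sq_mul_sum (M : ℕ) (u : ℂ) :
    (1 - u) ^ 2 * ∑ j ∈ Finset.range M, ((j + 1 : ℂ) + (M - 1 - j) * u ^ M) * u ^ j =
      (1 - u ^ M) ^ 2 := by
  have h1 : (1 - u) * ∑ j ∈ Finset.range M, u ^ j = 1 - u ^ M := mul_neg_geom_sum u M
  have h2 : ∀ n : ℕ, (1 - u) * ∑ j ∈ Finset.range n, (j + 1 : ℂ) * u ^ j =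
      ∑ j ∈ Finset.range n, u ^ j - n * u ^ n := fun n => by
    induction n with
    | zero => simp
    | succ n ih =>
      rw [Finset.sum_range_succ, mul_add, ih, Finset.sum_range_succ]
      push_cast
      ring
  have h3 : ∑ j ∈ Finset.range M, ((j + 1 : ℂ) + (M - 1 - j) * u ^ M) * u ^ j =
      (1 - u ^ M) * ∑ j ∈ Finset.range M, (j + 1 : ℂ) * u ^ j
        + M * u ^ M * ∑ j ∈ Finset.range M, u ^ j := by
    rw [Finset.mul_sum, Finset.mul_sum, ← Finset.sum_add_distrib]
    exact Finset.sum_congr rfl fun j _ => by ring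
  rw [h3]
  linear_combination (1 - u) * (1 - u ^ M) * h2 M + ((1 - u) * M * u ^ M + (1 - u ^ M)) * h1

theorem inv_one_sub_sq_eq_sum {M : ℕ} {u : ℂ} (hu : u ^ M ≠ 1) :
    ((1 - u) ^ 2)⁻¹ =
      (∑ j ∈ Finset.range M, ((j + 1 : ℂ) + (M - 1 - j) * u ^ M) * u ^ j) / (1 - u ^ M) ^ 2 := by
  have h1 : 1 - u ^ M ≠ 0 := sub_ne_zero.2 hu.symm
  have h2 : 1 - u ≠ 0 := fun h => hu (by rw [← sub_eq_zero.1 h, one_pow])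
  rw [← one_sub_sq_mul_sum M u] at *
  rw [inv_eq_one_div, eq_comm, div_eq_div_iff (by rw [one_sub_sq_mul_sum]; positivity) (by positivity)]
  ring

/-- The rotation `e^{i(θ_k - θ_m)}` between two branches. -/
noncomputable def branchRotation (M : ℕ) (m k : Fin M) : ℂ :=
  Complex.exp (Complex.I * (branchAngle M k - branchAngle M m : ℝ))

theorem branchRotation_self {M : ℕ} (m : Fin M) : branchRotation M m m = 1 := by
  simp [branchRotation]

theorem branchRotation_eq {M : ℕ} (m k : Fin M) :
    branchRotation M m k = Complex.exp (2 * Real.pi * Complex.I / M) ^ (k : ℕ) *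
      (Complex.exp (2 * Real.pi * Complex.I / M) ^ (m : ℕ))⁻¹ := by
  rw [branchRotation, ← Complex.exp_nat_mul, ← Complex.exp_nat_mul, ← Complex.exp_neg,
    ← Complex.exp_add]
  congr 1
  simp only [branchAngle]
  push_cast
  ring

theorem branchRotation_pow_card {M : ℕ} (m k : Fin M) : branchRotation M m k ^ M = 1 := by
  have hM : M ≠ 0 := fun h => by subst h; exact m.elim0
  have h := (Complex.isPrimitiveRoot_exp M hM).pow_eq_one
  rw [branchRotation_eq, mul_pow, inv_pow, ← pow_mul, ← pow_mul, mul_comm, mul_comm (m : ℕ),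
    mul_comm (k : ℕ), pow_mul, pow_mul, h]
  simp

theorem sum_branchRotation_pow {M : ℕ} (m : Fin M) {j : ℕ} (hj : 0 < j) (hjM : j < M) :
    ∑ k : Fin M, branchRotation M m k ^ j = 0 := by
  have hM : M ≠ 0 := by omega
  have hp := Complex.isPrimitiveRoot_exp M hM
  set ρ := Complex.exp (2 * Real.pi * Complex.I / M)
  have h1 : ∀ k : Fin M, branchRotation M m k ^ j = (ρ ^ j) ^ (k : ℕ) * ((ρ ^ (m : ℕ))⁻¹) ^ j :=
    fun k => by rw [branchRotation_eq, mul_pow, ← pow_mul, ← pow_mul, mul_comm j]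
  simp only [h1]
  rw [← Finset.sum_mul, Fin.sum_univ_eq_sum_range (fun i => (ρ ^ j) ^ i)]
  have h2 : (1 - ρ ^ j) * ∑ i ∈ Finset.range M, (ρ ^ j) ^ i = 0 := by
    rw [mul_neg_geom_sum, ← pow_mul, mul_comm, pow_mul, hp.pow_eq_one, one_pow, sub_self]
  have h3 : 1 - ρ ^ j ≠ 0 := fun h =>
    hp.pow_ne_one_of_pos_of_lt hj.ne' hjM (sub_eq_zero.1 h).symm
  rw [(mul_eq_zero.1 h2).resolve_left h3, zero_mul]

/-- The M-th power of w times a rotation does not depend on the branch, so the folded expansion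
leaves only power sums of roots of unity. These vanish unless M divides the exponent: only j = 0
survives when i = 0, and only j = M - 1 when i = 1. -/
theorem sum_branchRotation_pow_mul_inv {M : ℕ} (m : Fin M) {w : ℂ} (hw : w ^ M ≠ 1) (i : ℕ) :
    ∑ k : Fin M, branchRotation M m k ^ i * ((1 - w * branchRotation M m k) ^ 2)⁻¹ =
      (∑ j ∈ Finset.range M, ((j + 1 : ℂ) + (M - 1 - j) * w ^ M) * w ^ j *
        ∑ k : Fin M, branchRotation M m k ^ (i + j)) / (1 - w ^ M) ^ 2 := by
  have h1 : ∀ k : Fin M, (w * branchRotation M m k) ^ M = w ^ M := fun k => by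
    rw [mul_pow, branchRotation_pow_card, mul_one]
  have h2 : ∀ k : Fin M, branchRotation M m k ^ i * ((1 - w * branchRotation M m k) ^ 2)⁻¹ =
      (∑ j ∈ Finset.range M, ((j + 1 : ℂ) + (M - 1 - j) * w ^ M) * w ^ j *
        branchRotation M m k ^ (i + j)) / (1 - w ^ M) ^ 2 := fun k => by
    rw [inv_one_sub_sq_eq_sum (M := M) (by rwa [h1]), h1, ← mul_div_assoc, Finset.mul_sum]
    congr 1
    exact Finset.sum_congr rfl fun j _ => by rw [mul_pow, pow_add]; ring
  simp only [h2]
  rw [← Finset.sum_div, Finset.sum_comm]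
  simp only [Finset.mul_sum]

theorem sum_inv_one_sub_mul_branchRotation_sq {M : ℕ} (m : Fin M) {w : ℂ} (hw : w ^ M ≠ 1) :
    ∑ k : Fin M, ((1 - w * branchRotation M m k) ^ 2)⁻¹ =
      M * (1 + (M - 1) * w ^ M) / (1 - w ^ M) ^ 2 := by
  have hM : 0 < M := m.pos
  have h := sum_branchRotation_pow_mul_inv m hw 0
  simp only [pow_zero, one_mul, zero_add] at h
  rw [h, Finset.sum_eq_single_of_mem 0 (Finset.mem_range.2 hM) fun j hj hj0 => by
    rw [sum_branchRotation_pow m (Nat.pos_of_ne_zero hj0) (Finset.mem_range.1 hj), mul_zero]]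
  simp
  ring

theorem sum_branchRotation_div_sq {M : ℕ} (m : Fin M) {w : ℂ} (hw : w ^ M ≠ 1) :
    ∑ k : Fin M, branchRotation M m k * ((1 - w * branchRotation M m k) ^ 2)⁻¹ =
      M ^ 2 * w ^ (M - 1) / (1 - w ^ M) ^ 2 := by
  have hM : 0 < M := m.pos
  have h := sum_branchRotation_pow_mul_inv m hw 1
  simp only [pow_one] at h
  rw [h, Finset.sum_eq_single_of_mem (M - 1) (Finset.mem_range.2 (by omega)) fun j hj hj0 => by
    rw [sum_branchRotation_pow m (by omega) (by have := Finset.mem_range.1 hj; omega), mul_zero]]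
  rw [Nat.add_sub_cancel' hM]
  simp only [branchRotation_pow_card]
  simp
  push_cast [Nat.cast_sub hM]
  ring

/-! ### The finite parts in the linearized operator -/

theorem inv_one_sub_exp_sq (z : ℂ) :
    ((1 - Complex.exp (2 * z)) ^ 2)⁻¹ = Complex.exp (-(2 * z)) / Complex.sinh z ^ 2 / 4 := by
  have h1 : (1 - Complex.exp (2 * z)) ^ 2 = 4 * Complex.exp (2 * z) * Complex.sinh z ^ 2 := by
    have h2 : Complex.exp (2 * z) = Complex.exp z ^ 2 := by rw [← Complex.exp_nat_mul]; simp
    rw [h2, Complex.sinh, Complex.exp_neg]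
    have := Complex.exp_ne_zero z
    field_simp
    ring
  rw [h1, Complex.exp_neg, mul_inv, mul_inv]
  ring

theorem ccoth_neg (z : ℂ) : ccoth (-z) = -ccoth z := by
  rw [ccoth, ccoth, Complex.cosh_neg, Complex.sinh_neg, div_neg]

theorem ccoth_sub_pi_mul_I (z : ℂ) : ccoth (z - Real.pi * Complex.I) = ccoth z := by
  rw [ccoth, ccoth, ← sub_add_cancel z (Real.pi * Complex.I), Complex.cosh_add_pi_mul_I,
    Complex.sinh_add_pi_mul_I, neg_div_neg_eq, sub_add_cancel]

theorem add_I_ne_zero {a : ℝ} : (a : ℂ) + Complex.I ≠ 0 := fun h => by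
  simpa using congrArg Complex.im h

theorem exp_ne_one_of_re_ne_zero {z : ℂ} (hz : z.re ≠ 0) : Complex.exp z ≠ 1 := fun h => by
  have := congrArg norm h
  rw [Complex.norm_exp, norm_one, Real.exp_eq_one_iff] at this
  exact hz this

theorem hasImproperFinitePart_sum_inv_sq {M : ℕ} (hM : 3 ≤ M) {a : ℝ} (ha : 0 < a) (m : Fin M) :
    HasImproperFinitePart (fun σ : ℝ => Complex.exp (2 * a * σ) * ∑ k : Fin M,
        ((1 - Complex.exp ((a + Complex.I) * σ) * branchRotation M m k) ^ 2)⁻¹)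
      (Real.pi * Complex.I * (a - Complex.I) / (a + Complex.I) ^ 2 *
        ccoth (Real.pi * spiralA a / M)) := by
  have hMpos : (0 : ℝ) < M := by exact_mod_cast (by omega : 0 < M)
  have hM3 : (3 : ℝ) ≤ M := by exact_mod_cast hM
  have hM0 : (M : ℂ) ≠ 0 := by exact_mod_cast hMpos.ne'
  have hc := add_I_ne_zero (a := a)
  set l : ℂ := M * (a + Complex.I) / 2 with hl
  have hlre : l.re = M * a / 2 := by simp [hl]
  have hlpos : 0 < l.re := by rw [hlre]; positivity
  have hTa : (2 * a : ℂ) * (Real.pi * Complex.I / l) / 2 = -(Real.pi * spiralA a / M) := by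
    rw [hl, spiralA]; field_simp
  have hTa' : (2 * a - 2 * l : ℂ) * (Real.pi * Complex.I / l) / 2 =
      -(Real.pi * spiralA a / M) - Real.pi * Complex.I := by
    rw [← hTa, hl]; field_simp
  have hre : ((2 * a : ℂ) * (Real.pi * Complex.I / l)).re ≠ 0 := by
    have e : (2 * a : ℂ) * (Real.pi * Complex.I / l) =
        ((4 * a * Real.pi / (M * (a ^ 2 + 1)) : ℝ) : ℂ) * (1 + a * Complex.I) := by
      have h2 : (a : ℂ) ^ 2 + 1 ≠ 0 := by exact_mod_cast (by positivity : a ^ 2 + 1 ≠ 0)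
      rw [hl]; push_cast; field_simp
      linear_combination (-4 * a ^ 2 : ℂ) * Complex.I_sq
    have := Real.pi_pos
    rw [e, Complex.re_ofReal_mul]
    exact mul_ne_zero (by positivity) (by simp)
  -- The decay condition reads 2a < Ma, which is where three branches are needed.
  have h1 := hasImproperFinitePart_exp_div_sinh_sq (p := 2 * a) hlpos
    (by simp [abs_of_pos ha]; rw [hlre]; nlinarith) (exp_ne_one_of_re_ne_zero hre)
  have h2 := hasImproperFinitePart_exp_div_sinh_sq (p := 2 * a - 2 * l) hlpos
    (by
      simp only [Complex.sub_re, Complex.mul_re, Complex.re_ofNat, Complex.ofReal_re,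
        Complex.im_ofNat, Complex.ofReal_im, zero_mul, sub_zero]
      rw [hlre, abs_lt]
      constructor <;> nlinarith)
    (by
      have e : (2 * a - 2 * l : ℂ) * (Real.pi * Complex.I / l) =
          (2 * a : ℂ) * (Real.pi * Complex.I / l) - 2 * Real.pi * Complex.I := by
        rw [hl]; field_simp
      rw [e, Complex.exp_sub, Complex.exp_two_pi_mul_I, div_one]
      exact exp_ne_one_of_re_ne_zero hre)
  rw [hTa, ccoth_neg] at h1
  rw [hTa', ccoth_sub_pi_mul_I, ccoth_neg] at h2
  -- The summands 1 and (M - 1)w^M of the branch sum give the exponents 2a - 2l and 2a. Their coth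
  -- values agree by πi-periodicity.
  have h3 := (h2.const_mul (M / 4)).add (h1.const_mul (M * (M - 1) / 4))
  have hval : (M / 4 : ℂ) * -(Real.pi * Complex.I * (2 * a - 2 * l) / l ^ 2 *
        -ccoth (Real.pi * spiralA a / M))
      + M * (M - 1) / 4 * -(Real.pi * Complex.I * (2 * a) / l ^ 2 *
        -ccoth (Real.pi * spiralA a / M)) =
      Real.pi * Complex.I * (a - Complex.I) / (a + Complex.I) ^ 2 *
        ccoth (Real.pi * spiralA a / M) := by
    rw [hl]; field_simp; ring
  rw [hval] at h3
  refine h3.congr fun σ hσ => ?_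
  have hW : Complex.exp ((a + Complex.I) * σ) ^ M = Complex.exp (2 * (l * σ)) := by
    rw [← Complex.exp_nat_mul, hl]; congr 1; ring
  have hW1 : Complex.exp ((a + Complex.I) * σ) ^ M ≠ 1 := by
    rw [hW]
    refine exp_ne_one_of_re_ne_zero ?_
    simp [hlpos.ne', hσ]
  rw [sum_inv_one_sub_mul_branchRotation_sq m hW1, hW, div_eq_mul_inv _ ((1 - _) ^ 2), inv_one_sub_exp_sq,
    sub_mul, Complex.exp_sub, Complex.exp_neg]
  have := Complex.exp_ne_zero (2 * (l * σ))
  rw [← mul_assoc 2 l] at *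
  field_simp

theorem hasImproperFinitePart_sum_div_sq {M : ℕ} (hM : 3 ≤ M) {a β : ℝ} (ha : 0 < a)
    (hβ : 1 - 2 * a * β ≠ 0) (m : Fin M) :
    HasImproperFinitePart (fun σ : ℝ => Complex.exp ((2 * a + 2 * a * Complex.I * β + Complex.I) * σ) *
        ∑ k : Fin M, branchRotation M m k *
          ((1 - Complex.exp ((a + Complex.I) * σ) * branchRotation M m k) ^ 2)⁻¹)
      (Real.pi * Complex.I * a * (2 * Complex.I * β + 1) / (a + Complex.I) ^ 2 *
        ccoth (Real.pi * spiralB a β / M)) := by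
  have hMpos : (0 : ℝ) < M := by exact_mod_cast (by omega : 0 < M)
  have hM3 : (3 : ℝ) ≤ M := by exact_mod_cast hM
  have hM0 : (M : ℂ) ≠ 0 := by exact_mod_cast hMpos.ne'
  have hc := add_I_ne_zero (a := a)
  have h2 : (a : ℂ) ^ 2 + 1 ≠ 0 := by exact_mod_cast (by positivity : a ^ 2 + 1 ≠ 0)
  have h2' : (1 : ℂ) + (a : ℂ) ^ 2 ≠ 0 := by rwa [add_comm]
  set l : ℂ := M * (a + Complex.I) / 2 with hl
  have hlre : l.re = M * a / 2 := by simp [hl]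
  have hlpos : 0 < l.re := by rw [hlre]; positivity
  set p : ℂ := a * (2 * Complex.I * β + 1) with hp
  have hpre : p.re = a := by simp [hp]
  have hI : Complex.I / (a + Complex.I) = (1 + a * Complex.I) / (1 + a ^ 2) := by
    rw [div_eq_div_iff hc h2']
    linear_combination (-a : ℂ) * Complex.I_sq
  have hT : p * (Real.pi * Complex.I / l) / 2 = -(Real.pi * spiralB a β / M) := by
    have e : p * (Real.pi * Complex.I / l) / 2 = p * Real.pi / M * (Complex.I / (a + Complex.I)) := by
      rw [hl]; field_simp
    rw [e, hI, spiralB, hp]; ring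
  -- The real part is a positive multiple of 1 - 2aβ, so `hβ` keeps the quasi-period factor off the
  -- unit circle.
  have hre : (p * (Real.pi * Complex.I / l)).re ≠ 0 := by
    have e : p * (Real.pi * Complex.I / l) =
        ((2 * a * Real.pi / (M * (1 + a ^ 2)) : ℝ) : ℂ) *
          ((2 * Complex.I * β + 1) * (1 + a * Complex.I)) := by
      have e2 : p * (Real.pi * Complex.I / l) =
          2 * p * Real.pi / M * (Complex.I / (a + Complex.I)) := by
        rw [hl]; field_simp
      rw [e2, hI, hp]; push_cast; field_simp
    have hpi := Real.pi_pos
    rw [e, Complex.re_ofReal_mul]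
    refine mul_ne_zero (by positivity) ?_
    have : ((2 * Complex.I * β + 1) * (1 + a * Complex.I) : ℂ).re = 1 - 2 * a * β := by
      simp; ring
    rwa [this]
  have h1 := hasImproperFinitePart_exp_div_sinh_sq (p := p) hlpos
    (by rw [hpre, hlre, abs_of_pos ha]; nlinarith) (exp_ne_one_of_re_ne_zero hre)
  rw [hT, ccoth_neg] at h1
  have h3 := h1.const_mul (M ^ 2 / 4)
  have hval : (M ^ 2 / 4 : ℂ) * -(Real.pi * Complex.I * p / l ^ 2 *
        -ccoth (Real.pi * spiralB a β / M)) =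
      Real.pi * Complex.I * a * (2 * Complex.I * β + 1) / (a + Complex.I) ^ 2 *
        ccoth (Real.pi * spiralB a β / M) := by
    rw [hl, hp]; field_simp; ring
  rw [hval] at h3
  refine h3.congr fun σ hσ => ?_
  have hW : Complex.exp ((a + Complex.I) * σ) ^ M = Complex.exp (2 * (l * σ)) := by
    rw [← Complex.exp_nat_mul, hl]; congr 1; ring
  have hW1 : Complex.exp ((a + Complex.I) * σ) ^ M ≠ 1 := by
    rw [hW]
    refine exp_ne_one_of_re_ne_zero ?_
    simp [hlpos.ne', hσ]
  rw [sum_branchRotation_div_sq m hW1, hW, div_eq_mul_inv _ ((1 - _) ^ 2), inv_one_sub_exp_sq]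
  have he : Complex.exp (p * σ) = Complex.exp ((2 * a + 2 * a * Complex.I * β + Complex.I) * σ) *
      Complex.exp ((a + Complex.I) * σ) ^ (M - 1) * Complex.exp (-(2 * (l * σ))) := by
    rw [← Complex.exp_nat_mul, ← Complex.exp_add, ← Complex.exp_add]
    congr 1
    rw [hl, hp]
    push_cast [Nat.cast_sub (by omega : 1 ≤ M)]
    ring
  rw [he]
  ring

theorem hasImproperFinitePart_linBRIntegrand {M : ℕ} (hM : 3 ≤ M) {a α : ℝ} (ha : 0 < a)
    (h₁ : 1 - 2 * a * α ≠ 0) (h₂ : 1 - 2 * a * (-α) ≠ 0) {z : Fin M → ℝ → ℂ} {m : Fin M}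
    {θ : ℝ} {P Q : ℂ}
    (hz : ∀ (k : Fin M) (σ : ℝ), z k (σ + θ + (branchAngle M k - branchAngle M m)) =
      (P * Complex.exp (2 * a * Complex.I * α * σ) + Q * Complex.exp (-(2 * a * Complex.I * α * σ)))
        * (Complex.exp (Complex.I * σ) * Complex.exp (Complex.I * θ) * branchRotation M m k)) :
    HasImproperFinitePart (linBRIntegrand M a z m θ)
      (Complex.exp (-(Complex.I * θ)) * ((P + Q) *
          (Real.pi * Complex.I * (a - Complex.I) / (a + Complex.I) ^ 2 *
            ccoth (Real.pi * spiralA a / M))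
        - P * (Real.pi * Complex.I * a * (2 * Complex.I * α + 1) / (a + Complex.I) ^ 2 *
            ccoth (Real.pi * spiralB a α / M))
        - Q * (Real.pi * Complex.I * a * (2 * Complex.I * (-α : ℝ) + 1) / (a + Complex.I) ^ 2 *
            ccoth (Real.pi * spiralB a (-α) / M)))) := by
  have H := ((((hasImproperFinitePart_sum_inv_sq hM ha m).const_mul (P + Q)).add
    ((hasImproperFinitePart_sum_div_sq hM ha h₁ m).const_mul (-P))).add
    ((hasImproperFinitePart_sum_div_sq hM ha h₂ m).const_mul (-Q))).const_mul
    (Complex.exp (-(Complex.I * θ)))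
  convert! H using 1
  · have hz0 : z m θ = (P + Q) * Complex.exp (Complex.I * θ) := by
      have := hz m 0
      simpa [branchRotation_self] using this
    funext σ
    simp only [linBRIntegrand, Finset.mul_sum, ← Finset.sum_add_distrib]
    refine Finset.sum_congr rfl fun k _ => ?_
    rw [hz0, hz, ← branchRotation, div_eq_mul_inv]
    have e1 : Complex.exp (-2 * Complex.I * θ) =
        Complex.exp (-(Complex.I * θ)) * Complex.exp (-(Complex.I * θ)) := by
      rw [← Complex.exp_add]; ring_nf
    have e2 : Complex.exp (Complex.I * θ) * Complex.exp (-(Complex.I * θ)) = 1 := by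
      rw [← Complex.exp_add]; simp
    have e3 : Complex.exp ((2 * a + 2 * a * Complex.I * α + Complex.I) * σ) =
        Complex.exp (2 * a * σ) * Complex.exp (2 * a * Complex.I * α * σ)
          * Complex.exp (Complex.I * σ) := by
      rw [← Complex.exp_add, ← Complex.exp_add]; ring_nf
    have e4 : Complex.exp ((2 * a + 2 * a * Complex.I * (-α : ℝ) + Complex.I) * σ) =
        Complex.exp (2 * a * σ) * Complex.exp (-(2 * a * Complex.I * α * σ))
          * Complex.exp (Complex.I * σ) := by
      rw [← Complex.exp_add, ← Complex.exp_add]; push_cast; ring_nf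
    rw [e1, e3, e4]
    linear_combination (((P + Q) - (P * Complex.exp (2 * a * Complex.I * α * σ)
      + Q * Complex.exp (-(2 * a * Complex.I * α * σ))) * Complex.exp (Complex.I * σ) *
      branchRotation M m k) * Complex.exp (2 * a * σ) * Complex.exp (-(Complex.I * θ)) *
      ((1 - Complex.exp ((a + Complex.I) * σ) * branchRotation M m k) ^ 2)⁻¹) * e2
  · ring

/-! ### Noncollinearity, and rigidity of the spiral parameters -/

/-- Up to sign, the imaginary part is twice the area of the triangle p, q, r. -/
theorem ne_and_notMem_affineSpan_pair_iff (p q r : ℂ) :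
    (p ≠ q ∧ r ∉ affineSpan ℝ {p, q}) ↔ ((p - r) * conj (q - r)).im ≠ 0 := by
  constructor
  · rintro ⟨hpq, hr⟩ him
    -- The parameter is that of the orthogonal projection of r onto the line from p to q.
    refine hr (mem_affineSpan_pair_iff_exists_lineMap_eq.2
      ⟨((p - r) * conj (p - q)).re / Complex.normSq (p - q), ?_⟩)
    have hn : (Complex.normSq (p - q) : ℂ) ≠ 0 := by
      exact_mod_cast (Complex.normSq_pos.2 (sub_ne_zero.2 hpq)).ne'
    have h1 : (((p - r) * conj (p - q)).re : ℂ) = (p - r) * conj (p - q) := by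
      apply Complex.ext
      · simp
      · have : ((p - r) * conj (p - q)).im =
            ((p - r) * conj (p - r)).im - ((p - r) * conj (q - r)).im := by
          simp; ring
        rw [this, him, Complex.mul_conj]
        simp
    rw [AffineMap.lineMap_apply_module]
    simp only [Complex.real_smul]
    push_cast
    rw [h1]
    have hc := Complex.mul_conj (p - q)
    field_simp
    rw [← hc]
    ring
  · intro him
    refine ⟨fun h => him ?_, fun h => him ?_⟩
    · rw [h, Complex.mul_conj]; simp
    · obtain ⟨s, hs⟩ := mem_affineSpan_pair_iff_exists_lineMap_eq.1 h
      rw [AffineMap.lineMap_apply_module] at hs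
      simp only [Complex.real_smul] at hs
      have e1 : p - r = s * (p - q) := by rw [← hs]; push_cast; ring
      have e2 : q - r = (s - 1 : ℝ) * (p - q) := by rw [← hs]; push_cast; ring
      rw [e1, e2, map_mul, Complex.conj_ofReal]
      have : (s : ℂ) * (p - q) * ((s - 1 : ℝ) * conj (p - q)) =
          (s * (s - 1) * Complex.normSq (p - q) : ℝ) := by
        push_cast
        rw [← Complex.mul_conj (p - q)]
        ring
      rw [this, Complex.ofReal_im]

theorem nonCollinearCoeffs_iff (M : ℕ) (a g α : ℝ) :
    NonCollinearCoeffs M a g α ↔ ((coeffMode M a g α - coeffZero M a g) *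
      conj (coeffMode M a g (-α) - coeffZero M a g)).im ≠ 0 :=
  ne_and_notMem_affineSpan_pair_iff _ _ _

theorem exists_sq_eq_of_im_ne_zero {z : ℂ} (hz : z.im ≠ 0) : ∃ w : ℂ, 0 < w.re ∧ w ^ 2 = z := by
  obtain ⟨w, hw⟩ := IsAlgClosed.exists_pow_nat_eq z (n := 2) (by norm_num)
  have hre : w.re ≠ 0 := fun h => hz (by rw [← hw, sq, Complex.mul_im, h]; ring)
  rcases lt_or_gt_of_ne hre with h | h
  · exact ⟨-w, by simpa using h, by rw [neg_sq, hw]⟩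
  · exact ⟨w, h, hw⟩

theorem IsAlexanderSpiral.re_im {M : ℕ} {a g μ : ℝ} (h : IsAlexanderSpiral M a g μ) :
    a ^ 2 + 1 - 2 * μ = -2 * a ^ 2 * g * (ccoth (Real.pi * spiralA a / M)).re ∧
      2 * a * μ = -2 * a ^ 2 * g * (ccoth (Real.pi * spiralA a / M)).im := by
  have e : ((a ^ 2 + 1 - 2 * μ : ℝ) : ℂ) + ((2 * a * μ : ℝ) : ℂ) * Complex.I =
      ((-2 * a ^ 2 * g : ℝ) : ℂ) * ccoth (Real.pi * spiralA a / M) := by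
    push_cast
    exact h.2
  have re := congrArg Complex.re e
  have im := congrArg Complex.im e
  rw [Complex.re_ofReal_mul] at re
  rw [Complex.im_ofReal_mul] at im
  simp only [Complex.add_re, Complex.add_im, Complex.re_ofReal_mul, Complex.im_ofReal_mul,
    Complex.ofReal_re, Complex.ofReal_im, Complex.I_re, Complex.I_im, mul_zero, mul_one, add_zero,
    zero_add] at re im
  exact ⟨re, im⟩

/-- The real and imaginary parts are linear in g and μ. Eliminating μ leaves g times a constant
equal to -(a² + 1) ≠ 0, so the constant is nonzero and g is determined. This makes the growth
constants independent of g and μ. -/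
theorem IsAlexanderSpiral.unique {M : ℕ} {a g g' μ μ' : ℝ} (ha : 0 < a)
    (h : IsAlexanderSpiral M a g μ) (h' : IsAlexanderSpiral M a g' μ') : g = g' ∧ μ = μ' := by
  obtain ⟨re, im⟩ := h.re_im
  obtain ⟨re', im'⟩ := h'.re_im
  set K := ccoth (Real.pi * spiralA a / M)
  have hμ : μ = -(a * g * K.im) := by
    have : 2 * a * (μ + a * g * K.im) = 0 := by linarith
    rcases mul_eq_zero.1 this with h | h
    · linarith
    · linarith
  have hμ' : μ' = -(a * g' * K.im) := by
    have : 2 * a * (μ' + a * g' * K.im) = 0 := by linarith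
    rcases mul_eq_zero.1 this with h | h
    · linarith
    · linarith
  have hg : g * (2 * a * K.im + 2 * a ^ 2 * K.re) = -(a ^ 2 + 1) := by rw [hμ] at re; linarith
  have hg' : g' * (2 * a * K.im + 2 * a ^ 2 * K.re) = -(a ^ 2 + 1) := by
    rw [hμ'] at re'; linarith
  have hne : 2 * a * K.im + 2 * a ^ 2 * K.re ≠ 0 := fun h0 => by
    rw [h0, mul_zero] at hg
    nlinarith [sq_nonneg a]
  have hgg : g = g' := mul_right_cancel₀ hne (hg.trans hg'.symm)
  exact ⟨hgg, by rw [hμ, hμ', hgg]⟩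

/-! ### Power-law modes: the equation and the lower bound -/

/-- For a continuous function, the set where the essential bound holds is closed, and it is dense
because it has full measure. -/
theorem enorm_le_eLpNorm_top {E : Type*} [NormedAddCommGroup E] {f : ℝ → E} (hf : Continuous f)
    (x : ℝ) : ‖f x‖ₑ ≤ eLpNorm f ⊤ volume := by
  rw [eLpNorm_exponent_top]
  have hae := enorm_ae_le_eLpNormEssSup f (volume : Measure ℝ)
  have hd : Dense {x | ‖f x‖ₑ ≤ eLpNormEssSup f volume} := Measure.dense_of_ae hae
  have hc : IsClosed {x | ‖f x‖ₑ ≤ eLpNormEssSup f volume} :=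
    isClosed_le hf.enorm continuous_const
  have := hd.closure_eq
  rw [hc.closure_eq] at this
  exact this.ge (mem_univ x)

/-- The angle shift cancels the branch offset, so the value does not depend on k and leaves the
branch sum as a factor. -/
theorem fourierMode_shift (M : ℕ) (a μ β : ℝ) (m k : Fin M) (t θ σ : ℝ) :
    fourierMode M a μ β k t (σ + θ + (branchAngle M k - branchAngle M m)) =
      fourierMode M a μ β m t θ * Complex.exp (2 * a * Complex.I * β * σ) := by
  rw [fourierMode, fourierMode, ← Complex.exp_add]
  congr 1
  push_cast
  ring

theorem modePerturbation_shift {M : ℕ} {a μ α : ℝ} {x y : ℝ → ℂ} (m k : Fin M) (t θ σ : ℝ) :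
    modePerturbation M a μ α (fun _ => x) (fun _ => y) k t
        (σ + θ + (branchAngle M k - branchAngle M m)) =
      (x t * fourierMode M a μ α m t θ * Complex.exp (2 * a * Complex.I * α * σ)
        + y t * fourierMode M a μ (-α) m t θ * Complex.exp (-(2 * a * Complex.I * α * σ))) *
      (Complex.exp (Complex.I * σ) * Complex.exp (Complex.I * θ) * branchRotation M m k) := by
  have e : Complex.exp (Complex.I * ((σ + θ + (branchAngle M k - branchAngle M m) : ℝ) : ℂ)) =
      Complex.exp (Complex.I * σ) * Complex.exp (Complex.I * θ) * branchRotation M m k := by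
    rw [branchRotation, ← Complex.exp_add, ← Complex.exp_add]
    congr 1
    push_cast
    ring
  have e2 : Complex.exp (2 * a * Complex.I * ((-α : ℝ) : ℂ) * σ) =
      Complex.exp (-(2 * a * Complex.I * α * σ)) := by
    congr 1; push_cast; ring
  rw [modePerturbation, fourierMode_shift, fourierMode_shift, e, e2]
  ring

/-- The growing amplitude `u t ^ lam`. -/
noncomputable def powerAmplitude (u lam : ℂ) (t : ℝ) : ℂ := u * Complex.exp (lam * (Real.log t : ℝ))

theorem norm_powerAmplitude (u lam : ℂ) {t : ℝ} (ht : 0 < t) :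
    ‖powerAmplitude u lam t‖ = ‖u‖ * t ^ lam.re := by
  rw [powerAmplitude, norm_mul, Complex.norm_exp, Real.rpow_def_of_pos ht, Complex.re_mul_ofReal,
    mul_comm lam.re]

theorem contDiffOn_powerAmplitude (u lam : ℂ) :
    ContDiffOn ℝ ∞ (powerAmplitude u lam) (Ioi 0) := by
  have h1 : ContDiffOn ℝ ∞ (fun t : ℝ => ((Real.log t : ℝ) : ℂ)) (Ioi 0) :=
    Complex.ofRealCLM.contDiff.comp_contDiffOn
      (Real.contDiffOn_log.mono fun t ht => (mem_Ioi.1 ht).ne')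
  exact contDiffOn_const.mul ((contDiffOn_const.mul h1).cexp)

theorem conj_modePerturbation {M : ℕ} {a μ α : ℝ} {u v lam : ℂ} (m : Fin M) (t θ : ℝ) :
    conj (modePerturbation M a μ α (fun _ => powerAmplitude u lam)
        (fun _ t => conj (powerAmplitude v lam t)) m t θ) =
      conj u * Complex.exp (conj lam * (Real.log t : ℝ)
        - Complex.I * (α * (2 * a * (θ - branchAngle M m) + (2 * μ - 1) * (Real.log t : ℝ)))
        - Complex.I * θ) +
      v * Complex.exp (lam * (Real.log t : ℝ)
        + Complex.I * (α * (2 * a * (θ - branchAngle M m) + (2 * μ - 1) * (Real.log t : ℝ)))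
        - Complex.I * θ) := by
  simp only [modePerturbation, fourierMode, powerAmplitude, map_add, map_mul, ← Complex.exp_conj,
    Complex.conj_I, Complex.conj_ofReal, Complex.conj_conj]
  rw [mul_assoc (conj u), mul_assoc (conj u), mul_assoc v, mul_assoc v]
  simp only [← Complex.exp_add]
  push_cast
  congr 3 <;> ring

theorem isLinBRSolution_modePerturbation {M : ℕ} (hM : 3 ≤ M) {a α g μ : ℝ} (ha : 0 < a)
    (h₁ : 1 - 2 * a * α ≠ 0) (h₂ : 1 - 2 * a * (-α) ≠ 0) {u v lam : ℂ}
    (hv : v * (lam + Complex.I * ((2 * μ - 1) / (2 * a) : ℝ)) =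
      u * (coeffMode M a g α - coeffZero M a g))
    (hu : u * (lam - Complex.I * ((2 * μ - 1) / (2 * a) : ℝ)) =
      v * conj (coeffMode M a g (-α) - coeffZero M a g)) :
    IsLinBRSolution M a g μ (modePerturbation M a μ α (fun _ => powerAmplitude u lam)
      (fun _ t => conj (powerAmplitude v lam t))) := by
  intro m t θ ht
  -- Conjugated because the e₁ part of the conjugate perturbation carries conj u and conj λ.
  have hu' : conj u * (conj lam + Complex.I * ((2 * μ - 1) / (2 * a) : ℝ)) =
      conj v * (coeffMode M a g (-α) - coeffZero M a g) := by
    have := congrArg conj hu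
    simpa only [map_mul, map_sub, Complex.conj_I, Complex.conj_ofReal, Complex.conj_conj, neg_mul,
      sub_neg_eq_add] using this
  have hFP := hasImproperFinitePart_linBRIntegrand hM ha h₁ h₂ (m := m) (θ := θ)
    fun k σ => modePerturbation_shift (M := M) (a := a) (μ := μ) (α := α)
      (x := powerAmplitude u lam) (y := fun t => conj (powerAmplitude v lam t)) m k t θ σ
  simp only [conj_modePerturbation]
  set ψ : ℂ := α * (2 * a * (θ - branchAngle M m) + (2 * μ - 1) * (Real.log t : ℝ)) with hψ
  have ht0 : (t : ℂ) ≠ 0 := by exact_mod_cast ht.ne'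
  have hlog : HasDerivAt (fun s : ℝ => ((Real.log s : ℝ) : ℂ)) (t : ℂ)⁻¹ t := by
    simpa using (Real.hasDerivAt_log ht.ne').ofReal_comp
  have hid : HasDerivAt (fun s : ℝ => (s : ℂ)) 1 θ := Complex.ofRealCLM.hasDerivAt
  set e₁ := Complex.exp (conj lam * (Real.log t : ℝ) - Complex.I * ψ - Complex.I * θ) with he₁
  set e₂ := Complex.exp (lam * (Real.log t : ℝ) + Complex.I * ψ - Complex.I * θ) with he₂
  refine ⟨conj u * (e₁ * ((conj lam - Complex.I * (α * (2 * μ - 1))) * (t : ℂ)⁻¹)) +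
      v * (e₂ * ((lam + Complex.I * (α * (2 * μ - 1))) * (t : ℂ)⁻¹)),
    conj u * (e₁ * (-Complex.I * (α * (2 * a)) - Complex.I)) +
      v * (e₂ * (Complex.I * (α * (2 * a)) - Complex.I)), _, ?_, ?_, hFP, ?_⟩
  · have hψt : HasDerivAt (fun s : ℝ => Complex.I * (α * (2 * a * (θ - branchAngle M m : ℂ)
        + (2 * μ - 1) * (Real.log s : ℝ)))) (Complex.I * (α * ((2 * μ - 1) * (t : ℂ)⁻¹))) t :=
      (((hlog.const_mul _).const_add _).const_mul _).const_mul _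
    refine (((((hlog.const_mul (conj lam)).sub hψt).sub_const (Complex.I * θ)).cexp.const_mul
      (conj u)).add ((((hlog.const_mul lam).add hψt).sub_const (Complex.I * θ)).cexp.const_mul
      v)).congr_deriv ?_
    simp only [he₁, he₂, hψ, Pi.sub_apply, Pi.add_apply]
    ring
  · have hψθ : HasDerivAt (fun s : ℝ => Complex.I * (α * (2 * a * (s - branchAngle M m : ℂ)
        + (2 * μ - 1) * (Real.log t : ℝ)))) (Complex.I * (α * (2 * a * 1))) θ :=
      ((((hid.sub_const _).const_mul _).add_const _).const_mul _).const_mul _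
    refine ((((hψθ.const_sub (conj lam * (Real.log t : ℝ))).sub (hid.const_mul Complex.I)).cexp.const_mul
      (conj u)).add (((hψθ.const_add (lam * (Real.log t : ℝ))).sub
      (hid.const_mul Complex.I)).cexp.const_mul v)).congr_deriv ?_
    simp only [he₁, he₂, hψ, Pi.sub_apply]
    ring
  · have hP : powerAmplitude u lam t * fourierMode M a μ α m t θ * Complex.exp (-(Complex.I * θ)) =
        u * e₂ := by
      rw [powerAmplitude, fourierMode, he₂, mul_assoc u, mul_assoc u, ← Complex.exp_add,
        ← Complex.exp_add, hψ]
      congr 2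
      push_cast
      ring
    have hQ : conj (powerAmplitude v lam t) * fourierMode M a μ (-α) m t θ *
        Complex.exp (-(Complex.I * θ)) = conj v * e₁ := by
      rw [powerAmplitude, fourierMode, he₁, map_mul, ← Complex.exp_conj, map_mul,
        Complex.conj_ofReal, mul_assoc (conj v), mul_assoc (conj v), ← Complex.exp_add,
        ← Complex.exp_add, hψ]
      congr 2
      push_cast
      ring
    have hpi : (Real.pi : ℂ) ≠ 0 := by exact_mod_cast Real.pi_ne_zero
    have ha0 : (a : ℂ) ≠ 0 := by exact_mod_cast ha.ne'
    have hI := Complex.I_ne_zero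
    have hRHS : -((a * g : ℝ) / (Real.pi * Complex.I) * (Complex.exp (-(Complex.I * θ)) *
        ((powerAmplitude u lam t * fourierMode M a μ α m t θ +
            conj (powerAmplitude v lam t) * fourierMode M a μ (-α) m t θ) *
          (Real.pi * Complex.I * (a - Complex.I) / (a + Complex.I) ^ 2 *
            ccoth (Real.pi * spiralA a / M))
        - powerAmplitude u lam t * fourierMode M a μ α m t θ *
          (Real.pi * Complex.I * a * (2 * Complex.I * α + 1) / (a + Complex.I) ^ 2 *
            ccoth (Real.pi * spiralB a α / M))
        - conj (powerAmplitude v lam t) * fourierMode M a μ (-α) m t θ *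
          (Real.pi * Complex.I * a * (2 * Complex.I * (-α : ℝ) + 1) / (a + Complex.I) ^ 2 *
            ccoth (Real.pi * spiralB a (-α) / M))))) =
        u * e₂ * (coeffMode M a g α - coeffZero M a g) +
          conj v * e₁ * (coeffMode M a g (-α) - coeffZero M a g) := by
      have hc := add_I_ne_zero (a := a)
      rw [← hP, ← hQ, coeffMode, coeffMode, coeffZero]
      push_cast
      field_simp
      ring
    rw [hRHS]
    push_cast at hv hu' ⊢
    have hcancel : (t : ℂ) * (t : ℂ)⁻¹ = 1 := mul_inv_cancel₀ ht0
    have hcancel' : (2 * μ - 1 : ℂ) / (2 * a) * (2 * a) = 2 * μ - 1 := by field_simp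
    -- The oscillations are constant along the transport field, which is `hcancel'`. Only the factor
    -- e^{-iθ} feels the angular derivative and produces the shift iN.
    linear_combination e₂ * hv + e₁ * hu' +
      (conj u * e₁ * (conj lam - Complex.I * (α * (2 * μ - 1))) +
        v * e₂ * (lam + Complex.I * (α * (2 * μ - 1)))) * hcancel +
      (conj u * e₁ - v * e₂) * Complex.I * α * hcancel'

/-- At fixed t the relative phase of the two oscillations takes every value as θ varies. Phases 0
and π/2 give the moduli |x + y| and |x - y|, whose maximum is at least |y|. -/
theorem le_eLpNorm_modePerturbation {M : ℕ} (hM : 0 < M) {a μ α : ℝ} (ha : 0 < a) (hα : 0 < α)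
    (x y : ℝ → ℂ) (t : ℝ) :
    ENNReal.ofReal ‖y t‖ ≤ eLpNorm (fun θ : ℝ => fun m : Fin M =>
      modePerturbation M a μ α (fun _ => x) (fun _ => y) m t θ) ⊤ volume := by
  set f : ℝ → Fin M → ℂ := fun θ m =>
    modePerturbation M a μ α (fun _ => x) (fun _ => y) m t θ with hf
  have hfc : Continuous f := by
    refine continuous_pi fun m => ?_
    simp only [hf, modePerturbation, fourierMode]
    fun_prop
  set m : Fin M := ⟨0, hM⟩
  have hval : ∀ θ : ℝ, ‖f θ m‖ = ‖x t * fourierMode M a μ α m t θ + y t * fourierMode M a μ (-α) m t θ‖ :=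
    fun θ => by
      have : f θ m = (x t * fourierMode M a μ α m t θ + y t * fourierMode M a μ (-α) m t θ) *
          Complex.exp (Complex.I * θ) := by simp only [hf, modePerturbation]; ring
      rw [this, norm_mul, mul_comm Complex.I, Complex.norm_exp_ofReal_mul_I, mul_one]
  have hphase : ∀ φ : ℝ, ∃ θ : ℝ, fourierMode M a μ α m t θ = Complex.exp (φ * Complex.I) ∧
      fourierMode M a μ (-α) m t θ = Complex.exp (-(φ * Complex.I)) := fun φ => by
    refine ⟨(φ / α - (2 * μ - 1) * Real.log t) / (2 * a) + branchAngle M m, ?_, ?_⟩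
    · rw [fourierMode, mul_comm]
      congr 3
      field_simp
      ring
    · rw [fourierMode, mul_comm, ← neg_mul, ← Complex.ofReal_neg]
      congr 3
      field_simp
      ring
  obtain ⟨θ₁, h₁, h₁'⟩ := hphase 0
  obtain ⟨θ₂, h₂, h₂'⟩ := hphase (Real.pi / 2)
  have e1 : ‖f θ₁ m‖ = ‖x t + y t‖ := by rw [hval, h₁, h₁']; simp
  have e2 : ‖f θ₂ m‖ = ‖x t - y t‖ := by
    have hI : Complex.exp (((Real.pi / 2 : ℝ) : ℂ) * Complex.I) = Complex.I := by
      push_cast; exact Complex.exp_pi_div_two_mul_I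
    rw [hval, h₂, h₂', Complex.exp_neg, hI, Complex.inv_I,
      show x t * Complex.I + y t * -Complex.I = (x t - y t) * Complex.I by ring, norm_mul,
      Complex.norm_I, mul_one]
  have hmax : ‖y t‖ ≤ ‖f θ₁ m‖ ∨ ‖y t‖ ≤ ‖f θ₂ m‖ := by
    by_contra! hcon
    rw [e1, e2] at hcon
    have h3 : ‖(x t + y t) - (x t - y t)‖ ≤ ‖x t + y t‖ + ‖x t - y t‖ := norm_sub_le _ _
    rw [show (x t + y t) - (x t - y t) = 2 * y t by ring, norm_mul, Complex.norm_ofNat] at h3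
    linarith [hcon.1, hcon.2]
  have hfin : ∀ θ : ℝ, ‖y t‖ ≤ ‖f θ m‖ → ENNReal.ofReal ‖y t‖ ≤ eLpNorm f ⊤ volume := fun θ hθ => by
    refine le_trans ?_ (enorm_le_eLpNorm_top hfc θ)
    rw [← ofReal_norm]
    exact ENNReal.ofReal_le_ofReal (hθ.trans (norm_le_pi_norm (f θ) m))
  rcases hmax with h | h
  · exact hfin _ h
  · exact hfin _ h

theorem exists_growing_mode {M : ℕ} (hM : 3 ≤ M) {a α : ℝ} (ha : 0 < a) (hα : 0 < α)
    (hα' : α ≠ 1 / (2 * a)) :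
    ∃ C δ : ℝ, 0 < C ∧ 0 < δ ∧
      ∀ g μ : ℝ, IsAlexanderSpiral M a g μ → NonCollinearCoeffs M a g α →
        ∃ X Y : Fin M → ℝ → ℂ,
          (∀ m, ContDiffOn ℝ ∞ (X m) (Ioi 0)) ∧
          (∀ m, ContDiffOn ℝ ∞ (Y m) (Ioi 0)) ∧
          IsLinBRSolution M a g μ (modePerturbation M a μ α X Y) ∧
          ∀ t : ℝ, 0 < t →
            ENNReal.ofReal (C * t ^ δ) ≤
              eLpNorm (fun θ : ℝ => fun m : Fin M => modePerturbation M a μ α X Y m t θ)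
                ⊤ volume := by
  -- The constants must precede g and μ. If an admissible pair exists it is unique and fixes them;
  -- otherwise any positive values do.
  by_cases hex : ∃ g μ : ℝ, IsAlexanderSpiral M a g μ ∧ NonCollinearCoeffs M a g α
  swap
  · exact ⟨1, 1, one_pos, one_pos, fun g μ h h' => absurd ⟨g, μ, h, h'⟩ hex⟩
  obtain ⟨g, μ, hs, hnc⟩ := hex
  rw [nonCollinearCoeffs_iff] at hnc
  set v := coeffMode M a g α - coeffZero M a g with hv
  set N : ℝ := (2 * μ - 1) / (2 * a) with hN
  obtain ⟨lam, hlam, hsq⟩ := exists_sq_eq_of_im_ne_zero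
    (z := v * conj (coeffMode M a g (-α) - coeffZero M a g) - (N ^ 2 : ℝ)) (by
      rw [Complex.sub_im, Complex.ofReal_im, sub_zero]; exact hnc)
  have hv0 : v ≠ 0 := fun h0 => hnc (by simp [h0])
  refine ⟨‖v‖, lam.re, norm_pos_iff.2 hv0, hlam, fun g' μ' hs' _ => ?_⟩
  obtain ⟨rfl, rfl⟩ := hs.unique ha hs'
  -- With v = c^+ - c_0, taking u = λ + iN makes the first amplitude equation trivial and turns the
  -- second into the equation for λ².
  refine ⟨fun _ => powerAmplitude (lam + Complex.I * N) lam,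
    fun _ t => conj (powerAmplitude v lam t), fun _ => contDiffOn_powerAmplitude _ _,
    fun _ => Complex.conjCLE.contDiff.comp_contDiffOn (contDiffOn_powerAmplitude _ _), ?_, ?_⟩
  · refine isLinBRSolution_modePerturbation hM ha (fun h => hα' ?_) (by
      have : 0 < 2 * a * α := by positivity
      linarith) ?_ ?_
    · field_simp; linarith
    · rw [← hN, ← hv]; ring
    · rw [← hN]
      push_cast at hsq
      linear_combination hsq - (N : ℂ) ^ 2 * Complex.I_sq
  · intro t ht
    have h := le_eLpNorm_modePerturbation (M := M) (by omega) (μ := μ) ha hα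
      (powerAmplitude (lam + Complex.I * N) lam) (fun t => conj (powerAmplitude v lam t)) t
    rwa [RCLike.norm_conj, norm_powerAmplitude _ _ ht] at h

/-! ### Noncollinearity near resonance for large a -/

/-- `c^±(α)` without the factor `g a / (a + i)²`. -/
noncomputable def reducedMode (M : ℕ) (a β : ℝ) : ℂ :=
  a * (2 * Complex.I * β + 1) * ccoth (Real.pi * spiralB a β / M)

/-- `c_0` without the factor `g a / (a + i)²`. -/
noncomputable def reducedZero (M : ℕ) (a : ℝ) : ℂ :=
  (a - Complex.I) * ccoth (Real.pi * spiralA a / M)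

/-- The common complex factor multiplies the area by its squared modulus, so g plays no role beyond
being nonzero. -/
theorem nonCollinearCoeffs_of_reduced {M : ℕ} {a g α : ℝ} (ha : 0 < a) (hg : g ≠ 0)
    (h : ((reducedMode M a α - reducedZero M a) *
      conj (reducedMode M a (-α) - reducedZero M a)).im ≠ 0) : NonCollinearCoeffs M a g α := by
  rw [nonCollinearCoeffs_iff]
  have hc := add_I_ne_zero (a := a)
  set s : ℂ := g * a / (a + Complex.I) ^ 2 with hs
  have hs0 : s ≠ 0 := by
    have : (g : ℂ) ≠ 0 := by exact_mod_cast hg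
    have : (a : ℂ) ≠ 0 := by exact_mod_cast ha.ne'
    rw [hs]; positivity
  have hm : ∀ β : ℝ, coeffMode M a g β - coeffZero M a g =
      s * (reducedMode M a β - reducedZero M a) := fun β => by
    rw [coeffMode, coeffZero, reducedMode, reducedZero, hs]; ring
  rw [hm, hm, map_mul]
  have e : s * (reducedMode M a α - reducedZero M a) *
      (conj s * conj (reducedMode M a (-α) - reducedZero M a)) =
      (Complex.normSq s : ℂ) * ((reducedMode M a α - reducedZero M a) *
      conj (reducedMode M a (-α) - reducedZero M a)) := by
    rw [← Complex.mul_conj]; ring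
  rw [e, Complex.im_ofReal_mul]
  exact mul_ne_zero (Complex.normSq_pos.2 hs0).ne' h

theorem hasDerivAt_ccoth {z : ℂ} (hz : Complex.sinh z ≠ 0) :
    HasDerivAt ccoth (-(Complex.sinh z ^ 2)⁻¹) z := by
  refine ((Complex.hasDerivAt_cosh z).div (Complex.hasDerivAt_sinh z) hz).congr_deriv ?_
  field_simp
  linear_combination -Complex.cosh_sq_sub_sinh_sq z

theorem sinh_neg_mul_I (x : ℝ) : Complex.sinh (x * -Complex.I) = -(Real.sin x * Complex.I) := by
  rw [mul_neg, Complex.sinh_neg, Complex.sinh_mul_I, Complex.ofReal_sin]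

theorem ccoth_neg_mul_I {x : ℝ} : ccoth (x * -Complex.I) = (Real.cos x / Real.sin x : ℝ) * Complex.I := by
  rw [ccoth, sinh_neg_mul_I, mul_neg, Complex.cosh_neg, Complex.cosh_mul_I, ← Complex.ofReal_cos]
  push_cast
  rw [div_neg, mul_comm (Complex.sin _), ← div_div, Complex.div_I]
  ring

theorem continuousAt_reducedMode {M : ℕ} {a β : ℝ}
    (h : Complex.sinh (Real.pi * spiralB a β / M) ≠ 0) :
    ContinuousAt (fun β => reducedMode M a β) β := by
  have h1 : ContinuousAt (fun β : ℝ => (Real.pi * spiralB a β / M : ℂ)) β := by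
    simp only [spiralB]
    fun_prop
  have h2 : ContinuousAt (fun β : ℝ => ccoth (Real.pi * spiralB a β / M)) β :=
    ContinuousAt.comp (f := fun β : ℝ => (Real.pi * spiralB a β / M : ℂ))
      (hasDerivAt_ccoth h).continuousAt h1
  have h3 : ContinuousAt (fun β : ℝ => (a * (2 * Complex.I * β + 1) : ℂ)) β := by fun_prop
  exact h3.mul h2

theorem spiralB_resonant {a : ℝ} (ha : 0 < a) : spiralB a (1 / (2 * a)) = -Complex.I := by
  have h0 : (a : ℂ) ≠ 0 := by exact_mod_cast ha.ne'
  have h2 : (1 : ℂ) + a ^ 2 ≠ 0 := by exact_mod_cast (by positivity : 1 + a ^ 2 ≠ 0)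
  rw [spiralB]
  push_cast
  field_simp
  linear_combination (-a : ℂ) * Complex.I_sq

theorem spiralB_neg_resonant {a : ℝ} (ha : 0 < a) : spiralB a (-(1 / (2 * a))) =
    -Complex.I * ((1 - Complex.I * (a⁻¹ : ℝ)) / (1 + Complex.I * (a⁻¹ : ℝ))) := by
  have h0 : (a : ℂ) ≠ 0 := by exact_mod_cast ha.ne'
  have h2 : (1 : ℂ) + a ^ 2 ≠ 0 := by exact_mod_cast (by positivity : 1 + a ^ 2 ≠ 0)
  have h3 := add_I_ne_zero (a := a)
  rw [spiralB]
  push_cast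
  field_simp
  linear_combination (-(a : ℂ) ^ 2 + a * Complex.I) * Complex.I_sq

theorem spiralA_eq {a : ℝ} (ha : 0 < a) :
    spiralA a = 2 * -Complex.I / (1 + Complex.I * (a⁻¹ : ℝ)) := by
  have h0 : (a : ℂ) ≠ 0 := by exact_mod_cast ha.ne'
  have h3 := add_I_ne_zero (a := a)
  rw [spiralA]
  push_cast
  field_simp

/-- With h = 1/a the arguments of coth extend smoothly to h = 0. The differences are R + aQ and aQ,
so the term a²|Q|² is real and the imaginary part is a Im(R conj Q). As a → ∞, R involves the
derivative of coth along `b`, and Im(R conj Q) tends to -(2φ - sin 2φ)/(sin²φ sin 2φ). -/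
theorem eventually_reduced_ne_zero {M : ℕ} (hM : 3 ≤ M) : ∀ᶠ a : ℝ in atTop,
    Complex.sinh (Real.pi * spiralB a (-(1 / (2 * a))) / M) ≠ 0 ∧
    ((reducedMode M a (1 / (2 * a)) - reducedZero M a) *
      conj (reducedMode M a (-(1 / (2 * a))) - reducedZero M a)).im ≠ 0 := by
  have hM3 : (3 : ℝ) ≤ M := by exact_mod_cast hM
  have hM0 : (M : ℂ) ≠ 0 := by exact_mod_cast (by omega : M ≠ 0)
  set φ : ℝ := Real.pi / M with hφ
  have hφ0 : 0 < φ := div_pos Real.pi_pos (by linarith)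
  -- Uses M ≥ 3: with two branches sin 2φ would vanish and coth would have a pole at k(0).
  have hφ3 : 2 * φ < Real.pi := by
    rw [hφ, ← mul_div_assoc, div_lt_iff₀ (by linarith)]
    nlinarith [Real.pi_pos]
  have hs1 : 0 < Real.sin φ := Real.sin_pos_of_pos_of_lt_pi hφ0 (by linarith)
  have hs2 : 0 < Real.sin (2 * φ) := Real.sin_pos_of_pos_of_lt_pi (by linarith) hφ3
  have hscale : ∀ w : ℂ, Real.pi * w / M = φ * w := fun w => by
    rw [hφ]; push_cast; ring
  set b : ℝ → ℂ := fun h => φ * (-Complex.I * ((1 - Complex.I * h) / (1 + Complex.I * h))) with hb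
  set k : ℝ → ℂ := fun h => φ * (2 * -Complex.I / (1 + Complex.I * h)) with hk
  have hb0 : b 0 = φ * -Complex.I := by simp [hb]
  have hk0 : k 0 = (2 * φ : ℝ) * -Complex.I := by simp only [hk]; push_cast; simp; ring
  have hsb : Complex.sinh (b 0) ≠ 0 := by
    rw [hb0, sinh_neg_mul_I]
    simpa using (Complex.ofReal_ne_zero.2 hs1.ne')
  have hsk : Complex.sinh (k 0) ≠ 0 := by
    rw [hk0, sinh_neg_mul_I]
    simpa using (Complex.ofReal_ne_zero.2 hs2.ne')
  have hid : HasDerivAt (fun h : ℝ => (h : ℂ)) 1 0 := Complex.ofRealCLM.hasDerivAt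
  have hden : HasDerivAt (fun h : ℝ => 1 + Complex.I * (h : ℂ)) Complex.I 0 := by
    simpa using (hid.const_mul Complex.I).const_add 1
  have hnum : HasDerivAt (fun h : ℝ => 1 - Complex.I * (h : ℂ)) (-Complex.I) 0 := by
    simpa using (hid.const_mul Complex.I).const_sub 1
  have hbd : HasDerivAt b (-2 * φ) 0 := by
    refine (((hnum.div hden (by simp)).const_mul (-Complex.I)).const_mul (φ : ℂ)).congr_deriv ?_
    simp
    linear_combination (-2 * φ : ℂ) * Complex.I_sq
  have hkc : ContinuousAt k 0 :=
    (((hasDerivAt_const (0 : ℝ) (2 * -Complex.I)).div hden (by simp)).const_mul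
      (φ : ℂ)).continuousAt
  have hfd : HasDerivAt (fun h => ccoth (b h)) (-(Complex.sinh (b 0) ^ 2)⁻¹ * (-2 * φ)) 0 :=
    (hasDerivAt_ccoth hsb).comp (0 : ℝ) hbd
  have hinv : Tendsto (fun a : ℝ => a⁻¹) atTop (𝓝[>] 0) := tendsto_inv_atTop_nhdsGT_zero
  have hinv0 : Tendsto (fun a : ℝ => a⁻¹) atTop (𝓝 0) := tendsto_inv_atTop_zero
  -- The difference quotient with step 1/a is a(coth b(1/a) - coth b(0)), the part of R with the
  -- growing factor a.
  have hslope := hfd.tendsto_slope_zero_right.comp hinv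
  have hf := hfd.continuousAt.tendsto.comp hinv0
  have hkk : ContinuousAt (fun h => ccoth (k h)) 0 :=
    ContinuousAt.comp (f := k) (hasDerivAt_ccoth hsk).continuousAt hkc
  have hkt := hkk.tendsto.comp hinv0
  have hsin : Tendsto (fun a : ℝ => Complex.sinh (b a⁻¹)) atTop (𝓝 (Complex.sinh (b 0))) :=
    (Complex.continuous_sinh.tendsto (b 0)).comp (hbd.continuousAt.tendsto.comp hinv0)
  have hd := hnum.continuousAt.tendsto.comp hinv0
  have hlim := (((hslope.neg.add ((hf.const_add (ccoth (b 0))).const_mul Complex.I)).mul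
    ((Complex.continuous_conj.tendsto _).comp (hd.mul (hf.sub hkt)))))
  have hlim' := (Complex.continuous_im.tendsto _).comp hlim
  have hne : (Complex.im ((-(-(Complex.sinh (b 0) ^ 2)⁻¹ * (-2 * φ)) + Complex.I * (ccoth (b 0) + ccoth (b 0)))
      * conj ((1 - Complex.I * (0 : ℝ)) * (ccoth (b 0) - ccoth (k 0))))) ≠ 0 := by
    rw [hb0, hk0, ccoth_neg_mul_I, ccoth_neg_mul_I, sinh_neg_mul_I]
    set κ₁ := Real.cos φ / Real.sin φ with hκ₁
    set κ₂ := Real.cos (2 * φ) / Real.sin (2 * φ) with hκ₂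
    have hsq : ((-(Real.sin φ * Complex.I) : ℂ) ^ 2)⁻¹ = ((-(Real.sin φ ^ 2)⁻¹ : ℝ) : ℂ) := by
      push_cast
      rw [neg_sq, mul_pow, Complex.I_sq, mul_neg_one, inv_neg]
    have e : (-(-((-(Real.sin φ * Complex.I) : ℂ) ^ 2)⁻¹ * (-2 * φ)) +
        Complex.I * (κ₁ * Complex.I + κ₁ * Complex.I)) *
        conj ((1 - Complex.I * (0 : ℝ)) * (κ₁ * Complex.I - κ₂ * Complex.I)) =
        ((-(2 * φ * (Real.sin φ ^ 2)⁻¹ - 2 * κ₁) * (κ₁ - κ₂) : ℝ) : ℂ) * Complex.I := by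
      rw [hsq]
      simp only [map_mul, map_sub, Complex.conj_I, Complex.conj_ofReal, Complex.ofReal_zero,
        mul_zero, sub_zero, one_mul]
      push_cast
      linear_combination (-2 * κ₁ * (κ₁ - κ₂) * Complex.I : ℂ) * Complex.I_sq
    rw [e, Complex.im_ofReal_mul, Complex.I_im, mul_one]
    have h1 : 2 * φ * (Real.sin φ ^ 2)⁻¹ - 2 * κ₁ = (2 * φ - Real.sin (2 * φ)) / Real.sin φ ^ 2 := by
      rw [hκ₁, Real.sin_two_mul]; field_simp
    have h2 : κ₁ - κ₂ = 1 / Real.sin (2 * φ) := by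
      have hc : Real.cos φ * Real.sin (2 * φ) - Real.sin φ * Real.cos (2 * φ) = Real.sin φ := by
        have := Real.sin_sub (2 * φ) φ
        rw [show 2 * φ - φ = φ by ring] at this
        linarith
      rw [hκ₁, hκ₂, div_sub_div _ _ hs1.ne' hs2.ne', hc]
      field_simp
    rw [h1, h2]
    have h3 : 0 < 2 * φ - Real.sin (2 * φ) := sub_pos.2 (Real.sin_lt (by linarith))
    refine mul_ne_zero (neg_ne_zero.2 (by positivity)) (by positivity)
  filter_upwards [hlim'.eventually_ne hne, hsin.eventually_ne hsb, eventually_gt_atTop 0] with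
    a h1 h2 ha
  have ha0 : (a : ℂ) ≠ 0 := by exact_mod_cast ha.ne'
  have hbm : Real.pi * spiralB a (-(1 / (2 * a))) / M = b a⁻¹ := by
    rw [hscale, spiralB_neg_resonant ha]
  have hbp : Real.pi * spiralB a (1 / (2 * a)) / M = b 0 := by
    rw [hscale, spiralB_resonant ha, hb0]
  have hkm : Real.pi * spiralA a / M = k a⁻¹ := by rw [hscale, spiralA_eq ha]
  refine ⟨by rwa [hbm], ?_⟩
  rw [reducedMode, reducedMode, reducedZero, hbm, hbp, hkm]
  simp only [Function.comp_apply, zero_add] at h1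
  set Q : ℂ := (1 - Complex.I * (a⁻¹ : ℝ)) * (ccoth (b a⁻¹) - ccoth (k a⁻¹)) with hQ
  set R : ℂ := -((a⁻¹)⁻¹ • (ccoth (b a⁻¹) - ccoth (b 0))) +
    Complex.I * (ccoth (b 0) + ccoth (b a⁻¹)) with hR
  have eQ : a * (2 * Complex.I * ((-(1 / (2 * a)) : ℝ) : ℂ) + 1) * ccoth (b a⁻¹)
      - (a - Complex.I) * ccoth (k a⁻¹) = a * Q := by
    rw [hQ]; push_cast; field_simp; ring
  have eP : a * (2 * Complex.I * ((1 / (2 * a) : ℝ) : ℂ) + 1) * ccoth (b 0)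
      - (a - Complex.I) * ccoth (k a⁻¹) = R + a * Q := by
    rw [hQ, hR, inv_inv, Complex.real_smul]; push_cast; field_simp; ring
  rw [eQ, eP, map_mul, Complex.conj_ofReal]
  have e3 : (R + a * Q) * (a * conj Q) = (a : ℂ) * (R * conj Q) + ((a ^ 2 * Complex.normSq Q : ℝ) : ℂ) := by
    push_cast
    rw [← Complex.mul_conj]; ring
  rw [e3, Complex.add_im, Complex.ofReal_im, add_zero, Complex.im_ofReal_mul]
  exact mul_ne_zero ha.ne' h1

/-- At resonance B_+ = -i, so coth is evaluated at -iπ/M, away from its poles. The area is therefore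
continuous in α there and stays nonzero nearby. -/
theorem eventually_nonCollinearCoeffs {M : ℕ} (hM : 3 ≤ M) :
    ∀ᶠ a : ℝ in atTop, ∀ᶠ α : ℝ in 𝓝[≠] (1 / (2 * a)),
      ∀ g : ℝ, g ≠ 0 → NonCollinearCoeffs M a g α := by
  filter_upwards [eventually_reduced_ne_zero hM, eventually_gt_atTop 0] with a h ha
  have hMpos : (3 : ℝ) ≤ M := by exact_mod_cast hM
  have hp : Complex.sinh (Real.pi * spiralB a (1 / (2 * a)) / M) ≠ 0 := by
    have e : Real.pi * spiralB a (1 / (2 * a)) / M = ((Real.pi / M : ℝ) : ℂ) * -Complex.I := by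
      rw [spiralB_resonant ha]; push_cast; ring
    rw [e, sinh_neg_mul_I]
    have hs : 0 < Real.sin (Real.pi / M) :=
      Real.sin_pos_of_pos_of_lt_pi (div_pos Real.pi_pos (by linarith)) (by
        rw [div_lt_iff₀ (by linarith)]; nlinarith [Real.pi_pos])
    simpa using (Complex.ofReal_ne_zero.2 hs.ne')
  have hc1 := continuousAt_reducedMode hp
  have hc2 : ContinuousAt (fun β => reducedMode M a (-β)) (1 / (2 * a)) :=
    ContinuousAt.comp (f := fun β : ℝ => -β) (continuousAt_reducedMode h.1) continuousAt_neg
  have hc : ContinuousAt (fun β => ((reducedMode M a β - reducedZero M a) *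
      conj (reducedMode M a (-β) - reducedZero M a)).im) (1 / (2 * a)) :=
    Complex.continuous_im.continuousAt.comp ((hc1.sub continuousAt_const).mul
      (Complex.continuous_conj.continuousAt.comp (hc2.sub continuousAt_const)))
  have hev := (hc.tendsto.eventually_ne h.2).filter_mono
    (nhdsWithin_le_nhds (s := {1 / (2 * a)}ᶜ))
  filter_upwards [hev] with α hα g hg
  exact nonCollinearCoeffs_of_reduced ha hg hα

theorem theorem1p1 (M : ℕ) (hM : 3 ≤ M) :
    (∀ a α : ℝ, 0 < a → 0 < α → α ≠ 1 / (2 * a) →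
      ∃ C δ : ℝ, 0 < C ∧ 0 < δ ∧
        ∀ g μ : ℝ, IsAlexanderSpiral M a g μ → NonCollinearCoeffs M a g α →
          ∃ X Y : Fin M → ℝ → ℂ,
            (∀ m, ContDiffOn ℝ ∞ (X m) (Ioi 0)) ∧
            (∀ m, ContDiffOn ℝ ∞ (Y m) (Ioi 0)) ∧
            IsLinBRSolution M a g μ (modePerturbation M a μ α X Y) ∧
            ∀ t : ℝ, 0 < t →
              ENNReal.ofReal (C * t ^ δ) ≤
                eLpNorm (fun θ : ℝ => fun m : Fin M => modePerturbation M a μ α X Y m t θ)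
                  ⊤ volume) ∧
    (∀ᶠ a : ℝ in atTop, ∀ᶠ α : ℝ in 𝓝[≠] (1 / (2 * a)),
      ∀ g : ℝ, g ≠ 0 → NonCollinearCoeffs M a g α) :=
  ⟨fun _ _ ha hα hα' => exists_growing_mode hM ha hα hα', eventually_nonCollinearCoeffs hM⟩
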